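/- **Setting.** Let $d\ge 2$ and let $\lambda$ satisfy $0<\lambda<\dfrac{(2d-1)^{2d-1}}{(2d-2)^{2d}}$. Regard $\mathbb{Z}^d$ as a graph in which nodes at $\ell^1$-distance $1$ are adjacent. For finite $\Lambda\subset\mathbb{Z}^d$ let $Z_\Lambda=\sum_I\lambda^{|I|}$, the sum being over all independent sets $I\subset\Lambda$, and let $\partial\Lambda$ be the set of nodes of $\Lambda$ with a neighbour outside $\Lambda$. The *free energy* is $$\mathcal{P}=\mathcal{P}(d,\lambda)=\lim_{n\to\infty}\frac{\log Z_{\Lambda_n}}{|\Lambda_n|}$$ along any sequence of finite non-empty sets $\Lambda_n\subset\mathbb{Z}^d$ with $|\partial\Lambda_n|/|\Lambda_n|\to0$. For $a\in\mathbb{R}_{>0}^d$ put $B_{an}=\{u\in\mathbb{Z}^d:|u_j|\le a_jn,\ 1\le j\le d\}$, $A_j(a)=\prod_{k\ne j}2a_k$ and $A(a)=\sum_jA_j(a)$; the *surface pressure* is $$s\mathcal{P}=s\mathcal{P}(d,\lambda,a)=\lim_{n\to\infty}\frac{\log Z_{B_{an}}-|B_{an}|\,\mathcal{P}}{A(a)\,n^{d-1}}.$$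 **Algorithm.** For a subgraph $G$ of $\mathbb{Z}^d$ induced by a set $V$ of nodes, $v\in V$ and $t\ge0$ let $\Phi_G(v,0)=1$ and $$\Phi_G(v,t+1)=\Big(1+\lambda\prod_{i=1}^{k}\Phi_{G_{i-1}}(v_i,t)\Big)^{-1},$$ where $v_1,\dots,v_k$ are the neighbours of $v$ in $G$ (taken in the order $v-e_1,v+e_1,\dots,v-e_d,v+e_d$), $G_i$ is induced by $V\setminus\{v,v_1,\dots,v_i\}$, and an empty product is $1$. Let $\Psi_G$ satisfy the same recursion with $\Psi_G(v,0)=0$. Order $\mathbb{Z}^d$ by $v\prec u$ iff for some $k$ we have $v_k<u_k$ and $v_j=u_j$ for all $j>k$. Let $\Phi(t),\Psi(t)$ be the values $\Phi_G(0,t),\Psi_G(0,t)$ for the graph $G$ on the nodes $v\preceq0$, and $\Phi_{j,k,+}(t)$, $\Phi_{j,k,-}(t)$ the values $\Phi_G(0,t)$ for the graphs $G$ on the nodes $v\preceq0$ with $v_j\le k$, respectively with $v_j\ge-k$. The sequential cavity algorithm (SCA) with a constant $c\in\mathbb{N}$, on input $\epsilon>0$, computes $t=c(m+1)$, where $m\ge0$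 is the least integer with $2^{-m}\le\epsilon$, evaluates the above recursions, and returns * for the free energy, the two bounds $L=-\log\Phi(2t)$ and $U=-\log\Psi(2t)$; * for the surface pressure, $\displaystyle S=\sum_{j=1}^d\frac{A_j(a)}{A(a)}\sum_{k=0}^{t-1}\big(2\log\Phi(2t)-\log\Phi_{j,k,+}(2t)-\log\Phi_{j,k,-}(2t)\big).$ Its running time is the number of elementary steps of this recursive evaluation: arithmetic operations, logarithms and comparisons of real numbers, operations on integers (coordinates of nodes and loop counters), steps of list traversal (the removed nodes are kept in a list that is searched), and procedure calls, each counted as one step. **Proposition 2.** The limits defining $\mathcal{P}(d,\lambda)$ and, for every $a\in\mathbb{R}_{>0}^d$, $s\mathcal{P}(d,\lambda,a)$ exist. There are constants $c,C\in\mathbb{N}$ depending only on $d$ and $\lambda$ such that for every $\epsilon>0$ the SCA with constant $c$ produces, in time at most $\max(2,1/\epsilon)^{C}$ (that is, $(1/\epsilon)^{O(1)}$), numbers $L\le\mathcal{P}(d,\lambda)\le U$ with $U-L\le\epsilon$, so that every number of $[L,U]$ is an $\epsilon$-additive estimate of $\mathcal{P}(d,\lambda)$; and for every $a\in\mathbb{R}_{>0}^d$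 it produces, in time at most $\max(2,1/\epsilon)^{C}$, a number $S$ with $|S-s\mathcal{P}(d,\lambda,a)|\le\epsilon$. -/

import Mathlib

namespace HardCore

/-! ### The lattice and the hard-core model on it -/

/-- Nodes of the lattice `ℤ^d`. -/
abbrev Node (d : ℕ) : Type := Fin d → ℤ

/-- The lattice `ℤ^d` as a graph: nodes at `ℓ¹`-distance one are adjacent. -/
def lattice (d : ℕ) : SimpleGraph (Node d) where
  Adj v u := ∑ i, |v i - u i| = 1
  symm := ⟨fun v u h => by simpa only [abs_sub_comm] using h⟩
  loopless := ⟨fun v h => by simp at h⟩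

open Classical in
/-- The hard-core partition function of the subgraph of `ℤ^d` induced by the finite set `Λ`:
the sum of `lam ^ |I|` over the independent sets `I` contained in `Λ`. -/
noncomputable def partitionFunction (d : ℕ) (lam : ℝ) (Λ : Finset (Node d)) : ℝ :=
  ∑ I ∈ Λ.powerset.filter
      (fun I : Finset (Node d) => (lattice d).IsIndepSet (↑I : Set (Node d))), lam ^ I.card

open Classical in
/-- The boundary of `Λ`: the nodes of `Λ` that have a neighbour outside `Λ`. -/
noncomputable def boundary {d : ℕ} (Λ : Finset (Node d)) : Finset (Node d) :=
  Λ.filter fun v => ∃ u, (lattice d).Adj v u ∧ u ∉ Λ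

/-- `P` is the free energy (pressure) of the hard-core model with activity `lam` on `ℤ^d`:
`log Z_Λ / |Λ|` tends to `P` along every sequence of finite non-empty sets whose boundary is
negligible with respect to their volume. -/
def HasFreeEnergy (d : ℕ) (lam P : ℝ) : Prop :=
  ∀ Λ : ℕ → Finset (Node d), (∀ n, (Λ n).Nonempty) →
    Filter.Tendsto (fun n => ((boundary (Λ n)).card : ℝ) / ((Λ n).card : ℝ))
      Filter.atTop (nhds 0) →
    Filter.Tendsto (fun n => Real.log (partitionFunction d lam (Λ n)) / ((Λ n).card : ℝ))
      Filter.atTop (nhds P)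

/-- The rectangle `B_{an} = {u : |u_j| ≤ a_j n for all j}`. -/
noncomputable def rectangle {d : ℕ} (a : Fin d → ℝ) (n : ℕ) : Finset (Node d) :=
  Fintype.piFinset fun j => Finset.Icc (-⌊a j * n⌋) ⌊a j * n⌋

/-- `A_j(a) = ∏_{k ≠ j} 2 a_k`. -/
noncomputable def faceArea {d : ℕ} (a : Fin d → ℝ) (j : Fin d) : ℝ :=
  ∏ k ∈ Finset.univ.erase j, 2 * a k

/-- `A(a) = ∑_j A_j(a)`. -/
noncomputable def totalArea {d : ℕ} (a : Fin d → ℝ) : ℝ := ∑ j, faceArea a j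

/-- `s` is the surface pressure for the rectangular shape `a`, where `P` is the free energy:
the limit of `A(a)⁻¹ n^{-(d-1)} (log Z_{B_{an}} - |B_{an}| P)`. -/
def HasSurfacePressure (d : ℕ) (lam P : ℝ) (a : Fin d → ℝ) (s : ℝ) : Prop :=
  Filter.Tendsto
    (fun n : ℕ => (Real.log (partitionFunction d lam (rectangle a n))
        - ((rectangle a n).card : ℝ) * P) / (totalArea a * (n : ℝ) ^ (d - 1)))
    Filter.atTop (nhds s)

/-! ### Computations with a step count

A computation is a value together with the number of elementary steps that were spent on it.
Elementary steps are: one arithmetic operation, logarithm or comparison on real numbers, one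
operation on machine integers (such as the coordinates of a node and loop counters), one step of
list traversal, and one procedure call. -/

/-- A value together with the number of elementary steps spent on computing it. -/
structure Timed (α : Type) where
  /-- the result -/
  val : α
  /-- the number of elementary steps -/
  cost : ℕ

/-- Sequential composition adds the step counts. -/
instance : Monad Timed where
  pure x := ⟨x, 0⟩
  bind x f := ⟨(f x.val).val, x.cost + (f x.val).cost⟩

namespace Timed

/-- Spend `n` elementary steps. -/
def spend (n : ℕ) : Timed Unit := ⟨(), n⟩

/-- Addition, one step. -/
noncomputable def add (x y : ℝ) : Timed ℝ := ⟨x + y, 1⟩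

/-- Subtraction, one step. -/
noncomputable def sub (x y : ℝ) : Timed ℝ := ⟨x - y, 1⟩

/-- Multiplication, one step. -/
noncomputable def mul (x y : ℝ) : Timed ℝ := ⟨x * y, 1⟩

/-- Division, one step. -/
noncomputable def div (x y : ℝ) : Timed ℝ := ⟨x / y, 1⟩

/-- Natural logarithm, one step. -/
noncomputable def log (x : ℝ) : Timed ℝ := ⟨Real.log x, 1⟩

/-- The sum of the computed values `f i` along a list. -/
noncomputable def sum {ι : Type} (f : ι → Timed ℝ) : List ι → Timed ℝ
  | [] => do
      spend 1
      return 0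
  | i :: l => do
      spend 1
      let x ← f i
      let y ← sum f l
      add x y

/-- The product of the computed values `f i` along a list. -/
noncomputable def prod {ι : Type} (f : ι → Timed ℝ) : List ι → Timed ℝ
  | [] => do
      spend 1
      return 1
  | i :: l => do
      spend 1
      let x ← f i
      let y ← prod f l
      mul x y

end Timed

/-! ### The sequential cavity algorithm -/

/-- The lexicographic order on `ℤ^d` in which the last coordinate is the most significant. -/
def LexLT {d : ℕ} (v u : Node d) : Prop :=
  ∃ k, v k < u k ∧ ∀ j, k < j → v j = u j

/-- The whole lattice, and the half-spaces `{v : v_j ≤ k}` and `{v : v_j ≥ -k}`. -/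
inductive Domain (d : ℕ) : Type where
  | whole : Domain d
  | upper (j : Fin d) (k : ℕ) : Domain d
  | lower (j : Fin d) (k : ℕ) : Domain d

/-- The nodes of a domain. -/
def Domain.nodes {d : ℕ} : Domain d → Set (Node d)
  | .whole => Set.univ
  | .upper j k => {v | v j ≤ (k : ℤ)}
  | .lower j k => {v | -(k : ℤ) ≤ v j}

/-- The nodes of a domain that precede the origin lexicographically, and the origin itself. -/
def Domain.cavityNodes {d : ℕ} (D : Domain d) : Set (Node d) :=
  {v | v ∈ D.nodes ∧ (LexLT v 0 ∨ v = 0)}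

open Classical in
/-- Test whether a node lies in the cavity region of a domain: the coordinates are compared
with zero one by one, and one of them with the bound of the half-space. -/
noncomputable def testRegion {d : ℕ} (D : Domain d) (w : Node d) : Timed Bool :=
  ⟨decide (w ∈ D.cavityNodes), 2 * d + 2⟩

/-- Test whether a node occurs in a list, coordinate by coordinate. -/
def testMem {d : ℕ} (w : Node d) : List (Node d) → Timed Bool
  | [] => do
      Timed.spend 1
      return false
  | u :: l => do
      Timed.spend (d + 1)
      if u = w then return true else testMem w l

/-- The neighbours `v - e_i`, `v + e_i` (`i = 1, …, d`) of `v` in `ℤ^d`; each is written down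
coordinate by coordinate. -/
def listNeighbors {d : ℕ} (v : Node d) : Timed (List (Node d)) :=
  ⟨(List.finRange d).flatMap fun i =>
      [Function.update v i (v i - 1), Function.update v i (v i + 1)], 2 * d * (d + 2) + 1⟩

/-- Runs through a list of candidates. The current graph is the region of `D` without the nodes
in `removed`. Each candidate `w` in the current graph contributes the factor computed by
`child removed w`, and is then removed from the graph. -/
noncomputable def childProduct {d : ℕ} (D : Domain d)
    (child : List (Node d) → Node d → Timed ℝ) :
    List (Node d) → List (Node d) → Timed ℝ
  | [], _ => do
      Timed.spend 1
      return 1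
  | w :: ws, removed => do
      Timed.spend 1
      let inside ← testRegion D w
      let gone ← testMem w removed
      if inside = true ∧ gone = false then do
        let x ← child removed w
        let y ← childProduct D child ws (w :: removed)
        Timed.mul x y
      else
        childProduct D child ws removed

/-- The cavity recursion. For the graph `G` induced by the nodes of the region of `D` that are
not in `removed`, a node `v` of `G` and a depth `t`, it computes
`Φ_G(v, 0) = init` and `Φ_G(v, t + 1) = 1 / (1 + lam * ∏_{i ≤ k} Φ_{G_{i-1}}(v_i, t))`, where
`v_1, …, v_k` are the neighbours of `v` in `G` and `G_i` is `G` without `v, v_1, …, v_i`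
(the empty product is `1`). The initial value is `1` for `Φ` and `0` for `Ψ`. -/
noncomputable def cavity {d : ℕ} (D : Domain d) (lam init : ℝ) :
    ℕ → List (Node d) → Node d → Timed ℝ
  | 0, _, _ => do
      Timed.spend 1
      return init
  | t + 1, removed, v => do
      Timed.spend 1
      let ws ← listNeighbors v
      let p ← childProduct D (cavity D lam init t) ws (v :: removed)
      let q ← Timed.mul lam p
      let r ← Timed.add 1 q
      Timed.div 1 r

/-- The logarithm of `Φ` (for `init = 1`) or `Ψ` (for `init = 0`) at the origin of the cavity
region of `D`, at depth `t`. -/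
noncomputable def logCavity {d : ℕ} (D : Domain d) (lam init : ℝ) (t : ℕ) : Timed ℝ := do
  let x ← cavity D lam init t [] 0
  Timed.log x

/-- The level `t = c (m + 1)`, where `m` is the least number with `2^{-m} ≤ ε`. Starting from
`1`, one halves until the result is at most `ε`, and counts the halvings. -/
noncomputable def level (c : ℕ) (ε : ℝ) : Timed ℕ :=
  let m := sInf {m : ℕ | (1 / 2 : ℝ) ^ m ≤ ε}
  ⟨c * (m + 1), 3 * m + 3⟩

/-- The sequential cavity algorithm for the free energy. With `t` the level for accuracy `ε`, it
returns the bounds `-log Φ(2t)` and `-log Ψ(2t)`. -/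
noncomputable def scaFreeEnergy (d : ℕ) (lam : ℝ) (c : ℕ) (ε : ℝ) : Timed (ℝ × ℝ) := do
  let t ← level c ε
  Timed.spend 1
  let x ← logCavity (Domain.whole : Domain d) lam 1 (2 * t)
  let y ← logCavity (Domain.whole : Domain d) lam 0 (2 * t)
  let lo ← Timed.sub 0 x
  let hi ← Timed.sub 0 y
  return (lo, hi)

/-- Computes `A_j(a)`. -/
noncomputable def computeFaceArea {d : ℕ} (a : Fin d → ℝ) (j : Fin d) : Timed ℝ :=
  Timed.prod (fun k => do
    Timed.spend 1
    if k = j then return 1 else Timed.mul 2 (a k)) (List.finRange d)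

/-- The sequential cavity algorithm for the surface pressure. With `t` the level for accuracy
`ε`, it returns
`∑_j (A_j(a) / A(a)) ∑_{k < t} (2 log Φ(2t) - log Φ_{j,k,+}(2t) - log Φ_{j,k,-}(2t))`,
where `Φ_{j,k,±}` refers to the half-spaces `v_j ≤ k` and `v_j ≥ -k`. -/
noncomputable def scaSurfacePressure (d : ℕ) (lam : ℝ) (a : Fin d → ℝ) (c : ℕ) (ε : ℝ) :
    Timed ℝ := do
  let t ← level c ε
  Timed.spend 1
  let x ← logCavity (Domain.whole : Domain d) lam 1 (2 * t)
  let total ← Timed.sum (computeFaceArea a) (List.finRange d)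
  Timed.sum (fun j => do
    let area ← computeFaceArea a j
    let weight ← Timed.div area total
    let s ← Timed.sum (fun k => do
      let up ← logCavity (Domain.upper j k) lam 1 (2 * t)
      let low ← logCavity (Domain.lower j k) lam 1 (2 * t)
      let z ← Timed.mul 2 x
      let z' ← Timed.sub z up
      Timed.sub z' low) (List.range t)
    Timed.mul weight s) (List.finRange d)

end HardCore

namespace HardCore

/-! ### The contraction inequality -/

/-! The probability that a node is vacant in a finite hard-core model satisfies the cavity recursion
exactly: splitting the partition function at the node and telescoping over its neighbours gives
`cavityStep_vacancy`. By the chain rule in lexicographic order, `log_partitionFunction_eq_sum`, the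
logarithm of the partition function is therefore a sum over nodes `v` of a local quantity,
`limitEnergy`, for the graph of the nodes of the set up to `v`.

All estimates rest on decay of correlations. Each graph met in the recursion lacks a neighbour of
the current node (a lexicographic successor at the root, the parent afterwards), so a node has at
most `b = 2d - 1` children. In the coordinate `θ` with `cosh θ ^ 2 = 1 / p`, one step with `b`
children is a contraction with a rate below `1` when `lam < b^b / (b-1)^(b+1)`. This follows from
Cauchy–Schwarz, the inequality of the means and Bernoulli's inequality (`sq_gradient_le`,
`abs_angleMap_sub_le`). Hence the recursion forgets its initial values like `C * κ ^ t` (`decay`),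
and depth `t` sees the graph only up to distance `t` (`iterate_congr`).

Free energy: a node far from the complement contributes almost the value of the whole lattice, and
the other nodes are negligible (`hasFreeEnergy`). Two steps of the recursion are monotone, so even
iterates from `1` and from `0` enclose that value.

Surface pressure: a node of a box sees mainly its nearest face, so its excess is a sum over faces up
to an error governed by pairs of faces (`abs_energy_sub_faceExcess_le`). Summed over the box, the
main terms give one convergent series per face, and the pairs are of lower order than the surface
(`hasSurfacePressure`).

Complexity: evaluation to depth `t` costs at most exponentially many steps in `t`, while depth of
order `log (1/ε)` suffices for accuracy `ε`; the product is polynomial in `1/ε`. -/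

theorem pow_mul_sub_le_one (b : ℕ) {y : ℝ} (hy : 0 ≤ y) : y ^ b * (b + 1 - b * y) ≤ 1 := by
  rcases hy.eq_or_lt with rfl | hy
  · rcases Nat.eq_zero_or_pos b with rfl | hb
    · simp
    · simp [hb.ne']
  -- Bernoulli's inequality for `1/y` with exponent `b + 1`, multiplied by `y ^ (b + 1)`; equality
  -- holds at `y = 1`.
  · have h := one_add_mul_le_pow (a := y⁻¹ - 1) (by have := inv_pos.2 hy; linarith) (b + 1)
    have h2 := mul_le_mul_of_nonneg_right h (pow_pos hy (b + 1)).le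
    rw [← mul_pow, show (1 + (y⁻¹ - 1)) * y = 1 by field_simp; ring, one_pow] at h2
    refine le_trans (le_of_eq ?_) h2
    push_cast
    rw [pow_succ]
    field_simp
    ring

/-- The preceding inequality at `y = b q / (b - 1)`. It is tight at `q = (b - 1) / b`, the fixed
point of the recursion with `b` equal children at the critical activity, which is why the critical
value appears. -/
theorem critical_mul_le (b : ℕ) (hb : 2 ≤ b) {q : ℝ} (hq : 0 ≤ q) :
    (b : ℝ) ^ 2 * (1 - q) * ((b : ℝ) ^ b / (b - 1) ^ (b + 1) * q ^ b)
      ≤ 1 + (b : ℝ) ^ b / (b - 1) ^ (b + 1) * q ^ b := by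
  have hb' : (2 : ℝ) ≤ b := by exact_mod_cast hb
  have hb1 : (0 : ℝ) < b - 1 := by linarith
  have h := pow_mul_sub_le_one b (y := b * q / (b - 1)) (by positivity)
  have e : (b * q / (b - 1) : ℝ) ^ b * (b + 1 - b * (b * q / (b - 1)))
      = (b : ℝ) ^ b / (b - 1) ^ (b + 1) * q ^ b * ((b : ℝ) ^ 2 * (1 - q) - 1) := by
    rw [div_pow, mul_pow, pow_succ]
    field_simp
    ring
  rw [e] at h
  linarith

/-- The square of the contraction rate of the cavity recursion with at most `b` children. -/
noncomputable def rateSq (b : ℕ) (lam : ℝ) : ℝ :=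
  (lam / ((b : ℝ) ^ b / (b - 1) ^ (b + 1)) + lam) / (1 + lam)

theorem rateSq_nonneg {b : ℕ} (hb : 2 ≤ b) {lam : ℝ} (hlam : 0 < lam) : 0 ≤ rateSq b lam := by
  have hb' : (2 : ℝ) ≤ b := by exact_mod_cast hb
  have hb1 : (0 : ℝ) < b - 1 := by linarith
  unfold rateSq
  positivity

theorem rateSq_lt_one {b : ℕ} {lam : ℝ} (hlam : 0 < lam)
    (hlam' : lam < (b : ℝ) ^ b / (b - 1) ^ (b + 1)) : rateSq b lam < 1 := by
  unfold rateSq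
  have h := (div_lt_one (hlam.trans hlam')).2 hlam'
  rw [div_lt_one (by linarith)]
  linarith

/-- With `r` the ratio of `lam` to the critical activity and `X = lam * q ^ b`, the critical
inequality scaled by `r` bounds the left side by `r + X`. Since `r < 1`, the quotient `(r + X) / (1
+ X)` increases in `X`, and `X ≤ lam` gives the rate. -/
theorem sq_mul_le_rateSq {b : ℕ} (hb : 2 ≤ b) {lam : ℝ} (hlam : 0 < lam)
    (hlam' : lam < (b : ℝ) ^ b / (b - 1) ^ (b + 1)) {q : ℝ} (hq : 0 ≤ q) (hq1 : q ≤ 1) :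
    (b : ℝ) ^ 2 * (1 - q) * (lam * q ^ b) ≤ rateSq b lam * (1 + lam * q ^ b) := by
  have hc := critical_mul_le b hb hq
  set L := (b : ℝ) ^ b / (b - 1) ^ (b + 1) with hL
  have hLpos : 0 < L := hlam.trans hlam'
  set r := lam / L with hr
  have hr0 : 0 ≤ r := by positivity
  have hr1 : r < 1 := (div_lt_one hLpos).2 hlam'
  have hlr : lam = r * L := by rw [hr]; field_simp
  have hx0 : 0 ≤ q ^ b := pow_nonneg hq b
  have hx1 : q ^ b ≤ 1 := pow_le_one₀ hq hq1
  have h1 : (b : ℝ) ^ 2 * (1 - q) * (lam * q ^ b) ≤ r + lam * q ^ b := by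
    calc (b : ℝ) ^ 2 * (1 - q) * (lam * q ^ b)
        = r * ((b : ℝ) ^ 2 * (1 - q) * (L * q ^ b)) := by rw [hlr]; ring
      _ ≤ r * (1 + L * q ^ b) := mul_le_mul_of_nonneg_left hc hr0
      _ = r + lam * q ^ b := by rw [hlr]; ring
  refine h1.trans ?_
  have e : rateSq b lam = (r + lam) / (1 + lam) := rfl
  rw [e, div_mul_eq_mul_div, le_div_iff₀ (by linarith)]
  have := mul_nonneg (mul_nonneg hlam.le (sub_nonneg.2 hr1.le)) (sub_nonneg.2 hx1)
  nlinarith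

theorem prod_le_mean_pow {ι : Type*} [Fintype ι] [Nonempty ι] (p : ι → ℝ) (hp : ∀ i, 0 ≤ p i) :
    ∏ i, p i ≤ ((∑ i, p i) / Fintype.card ι) ^ Fintype.card ι := by
  have hc : (Fintype.card ι : ℝ) ≠ 0 := by exact_mod_cast Fintype.card_ne_zero
  have h := Real.geom_mean_le_arith_mean_weighted Finset.univ
    (fun _ => (Fintype.card ι : ℝ)⁻¹) p (fun _ _ => by positivity) (by simp [hc])
    (fun i _ => hp i)
  rw [← Finset.mul_sum, inv_mul_eq_div] at h
  have h2 := pow_le_pow_left₀ (Finset.prod_nonneg fun i _ => Real.rpow_nonneg (hp i) _) h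
    (Fintype.card ι)
  rw [← Finset.prod_pow] at h2
  refine le_trans (le_of_eq ?_) h2
  refine Finset.prod_congr rfl fun i _ => ?_
  rw [← Real.rpow_natCast, ← Real.rpow_mul (hp i), inv_mul_cancel₀ hc, Real.rpow_one]

theorem tanh_sq_eq (x : ℝ) : Real.tanh x ^ 2 = 1 - (Real.cosh x ^ 2)⁻¹ := by
  have h := Real.cosh_pos x
  have h2 := Real.cosh_sq x
  rw [Real.tanh_eq_sinh_div_cosh]
  field_simp
  linarith

/-- This bounds the squared `ℓ¹`-norm of the gradient of `angleMap`. Let `q` be the mean of the `p i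
= 1 / cosh ^ 2`. Cauchy–Schwarz and `tanh ^ 2 = 1 - p` bound the squared sum by `b ^ 2 * (1 - q)`,
and the inequality of the means bounds the product by `q ^ b`, which reduces everything to one
variable. -/
theorem sq_gradient_le {ι : Type*} [Fintype ι] (hb : 2 ≤ Fintype.card ι) {lam : ℝ}
    (hlam : 0 < lam)
    (hlam' : lam < (Fintype.card ι : ℝ) ^ Fintype.card ι
      / (Fintype.card ι - 1) ^ (Fintype.card ι + 1)) (θ : ι → ℝ) :
    (∑ i, |Real.tanh (θ i)|) ^ 2 * (lam * ∏ i, (Real.cosh (θ i) ^ 2)⁻¹)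
      ≤ rateSq (Fintype.card ι) lam * (1 + lam * ∏ i, (Real.cosh (θ i) ^ 2)⁻¹) := by
  have : Nonempty ι := Fintype.card_pos_iff.1 (by omega)
  set b := Fintype.card ι with hbdef
  have hb0 : (0 : ℝ) < b := by exact_mod_cast (by omega : 0 < b)
  set p : ι → ℝ := fun i => (Real.cosh (θ i) ^ 2)⁻¹ with hp
  have hp0 : ∀ i, 0 < p i := fun i => inv_pos.2 (pow_pos (Real.cosh_pos _) 2)
  have hp1 : ∀ i, p i ≤ 1 := fun i =>
    inv_le_one_of_one_le₀ (one_le_pow₀ (Real.one_le_cosh _))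
  set q := (∑ i, p i) / b with hq
  have hsum : ∑ i, p i = b * q := by rw [hq]; field_simp
  have hq0 : 0 ≤ q := div_nonneg (Finset.sum_nonneg fun i _ => (hp0 i).le) hb0.le
  have hq1 : q ≤ 1 := by
    rw [hq, div_le_one hb0]
    refine (Finset.sum_le_sum fun i _ => hp1 i).trans ?_
    simp [hbdef]
  have hprod : ∏ i, p i ≤ q ^ b := prod_le_mean_pow p fun i => (hp0 i).le
  have hprod0 : 0 ≤ ∏ i, p i := Finset.prod_nonneg fun i _ => (hp0 i).le
  have hcs : (∑ i, |Real.tanh (θ i)|) ^ 2 ≤ (b : ℝ) ^ 2 * (1 - q) := by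
    refine sq_sum_le_card_mul_sum_sq.trans (le_of_eq ?_)
    simp only [sq_abs, tanh_sq_eq, Finset.sum_sub_distrib]
    have : ∑ i, (Real.cosh (θ i) ^ 2)⁻¹ = b * q := hsum
    rw [this]
    simp [← hbdef]
    ring
  have hmain := sq_mul_le_rateSq hb hlam hlam' hq0 hq1
  set X := lam * ∏ i, p i with hX
  have hX0 : 0 ≤ X := mul_nonneg hlam.le hprod0
  set Y := lam * q ^ b with hY
  have hXY : X ≤ Y := mul_le_mul_of_nonneg_left hprod hlam.le
  have hk := rateSq_nonneg hb hlam
  have hq' : 0 ≤ (b : ℝ) ^ 2 * (1 - q) := by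
    have := sub_nonneg.2 hq1
    positivity
  refine (mul_le_mul_of_nonneg_right hcs hX0).trans ?_
  -- `X / (1 + X)` is increasing; the denominators are cleared by multiplying with `1 + Y`.
  have hY1 : 0 < 1 + Y := by linarith
  refine le_of_mul_le_mul_right ?_ hY1
  calc (b : ℝ) ^ 2 * (1 - q) * X * (1 + Y) ≤ (b : ℝ) ^ 2 * (1 - q) * Y * (1 + X) := by
        nlinarith
    _ ≤ rateSq b lam * (1 + Y) * (1 + X) := mul_le_mul_of_nonneg_right hmain (by linarith)
    _ = rateSq b lam * (1 + X) * (1 + Y) := by ring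

theorem hasDerivAt_log_cosh (x : ℝ) :
    HasDerivAt (fun y => Real.log (Real.cosh y)) (Real.tanh x) x := by
  have := (Real.hasDerivAt_cosh x).log (Real.cosh_pos x).ne'
  rwa [← Real.tanh_eq_sinh_div_cosh] at this

theorem abs_tanh_le_one (x : ℝ) : |Real.tanh x| ≤ 1 := by
  rw [← sq_le_one_iff_abs_le_one, tanh_sq_eq]
  have := inv_pos.2 (pow_pos (Real.cosh_pos x) 2)
  linarith

theorem abs_log_cosh_sub_le (x y : ℝ) :
    |Real.log (Real.cosh x) - Real.log (Real.cosh y)| ≤ |x - y| := by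
  have h := Convex.norm_image_sub_le_of_norm_hasDerivWithin_le
    (f := fun y => Real.log (Real.cosh y)) (f' := Real.tanh) (C := 1) (s := Set.univ) (x := y)
    (y := x) (fun z _ => (hasDerivAt_log_cosh z).hasDerivWithinAt)
    (fun z _ => by simpa using abs_tanh_le_one z) convex_univ trivial trivial
  simpa using h

/-- The cavity recursion in the coordinate in which it contracts. -/
noncomputable def angleMap {ι : Type*} [Fintype ι] (lam : ℝ) (θ : ι → ℝ) : ℝ :=
  Real.arsinh (√lam * ∏ i, (Real.cosh (θ i))⁻¹)

theorem prod_inv_cosh_eq_exp {ι : Type*} [Fintype ι] (θ : ι → ℝ) :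
    ∏ i, (Real.cosh (θ i))⁻¹ = Real.exp (-∑ i, Real.log (Real.cosh (θ i))) := by
  rw [← Finset.sum_neg_distrib, Real.exp_sum]
  refine Finset.prod_congr rfl fun i _ => ?_
  rw [Real.exp_neg, Real.exp_log (Real.cosh_pos _)]

/-- Mean value inequality along the segment from `θ` to `θ'`. With `u` the argument of `arsinh`, the
derivative is `-u / √(1 + u ^ 2)` times the sum of `tanh (θ i) * (θ' i - θ i)`, and `sq_gradient_le`
bounds it. -/
theorem abs_angleMap_sub_le {ι : Type*} [Fintype ι] (hb : 2 ≤ Fintype.card ι) {lam : ℝ}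
    (hlam : 0 < lam)
    (hlam' : lam < (Fintype.card ι : ℝ) ^ Fintype.card ι
      / (Fintype.card ι - 1) ^ (Fintype.card ι + 1)) (θ θ' : ι → ℝ) {δ : ℝ} (hδ0 : 0 ≤ δ)
    (hδ : ∀ i, |θ' i - θ i| ≤ δ) :
    |angleMap lam θ' - angleMap lam θ| ≤ √(rateSq (Fintype.card ι) lam) * δ := by
  set path : ℝ → ι → ℝ := fun s i => θ i + s * (θ' i - θ i) with hpath
  set u : ℝ → ℝ := fun s => √lam * Real.exp (-∑ i, Real.log (Real.cosh (path s i))) with hu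
  have hderiv : ∀ s, HasDerivAt (fun s => angleMap lam (path s))
      ((√(1 + u s ^ 2))⁻¹ • (√lam * (Real.exp (-∑ i, Real.log (Real.cosh (path s i)))
        * -∑ i, Real.tanh (path s i) * (θ' i - θ i)))) s := by
    intro s
    have h1 : ∀ i, HasDerivAt (fun s => path s i) (θ' i - θ i) s := fun i => by
      have h := ((hasDerivAt_id s).mul_const (θ' i - θ i)).const_add (θ i)
      rw [one_mul] at h
      exact h
    have h2 : ∀ i, HasDerivAt (fun s => Real.log (Real.cosh (path s i)))
        (Real.tanh (path s i) * (θ' i - θ i)) s := fun i =>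
      HasDerivAt.comp (h₂ := fun y => Real.log (Real.cosh y)) s (hasDerivAt_log_cosh (path s i))
        (h1 i)
    have h3 := (((HasDerivAt.fun_sum fun i (_ : i ∈ Finset.univ) => h2 i).neg.exp).const_mul
      (√lam)).arsinh
    simp only [angleMap, prod_inv_cosh_eq_exp]
    exact h3
  have hbound : ∀ s, ‖(√(1 + u s ^ 2))⁻¹ • (√lam *
      (Real.exp (-∑ i, Real.log (Real.cosh (path s i)))
        * -∑ i, Real.tanh (path s i) * (θ' i - θ i)))‖ ≤ √(rateSq (Fintype.card ι) lam) * δ := by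
    intro s
    have hus : 0 ≤ u s := by positivity
    have hsq : u s ^ 2 = lam * ∏ i, (Real.cosh (path s i) ^ 2)⁻¹ := by
      simp only [hu]
      rw [← prod_inv_cosh_eq_exp, mul_pow, Real.sq_sqrt hlam.le, ← Finset.prod_pow]
      simp only [inv_pow]
    have hgrad := sq_gradient_le hb hlam hlam' (path s)
    rw [← hsq] at hgrad
    have hsum : |∑ i, Real.tanh (path s i) * (θ' i - θ i)|
        ≤ (∑ i, |Real.tanh (path s i)|) * δ := by
      refine (Finset.abs_sum_le_sum_abs _ _).trans ?_
      rw [Finset.sum_mul]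
      refine Finset.sum_le_sum fun i _ => ?_
      rw [abs_mul]
      exact mul_le_mul_of_nonneg_left (hδ i) (abs_nonneg _)
    have hw : 0 < √(1 + u s ^ 2) := Real.sqrt_pos.2 (by positivity)
    have hS : 0 ≤ ∑ i, |Real.tanh (path s i)| := Finset.sum_nonneg fun i _ => abs_nonneg _
    have hrate : (∑ i, |Real.tanh (path s i)|) * u s
        ≤ √(rateSq (Fintype.card ι) lam) * √(1 + u s ^ 2) := by
      rw [← Real.sqrt_mul (rateSq_nonneg hb hlam)]
      refine Real.le_sqrt_of_sq_le ?_
      rw [mul_pow]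
      exact hgrad
    have e : (√(1 + u s ^ 2))⁻¹ • (√lam *
      (Real.exp (-∑ i, Real.log (Real.cosh (path s i)))
        * -∑ i, Real.tanh (path s i) * (θ' i - θ i)))
        = -((u s * ∑ i, Real.tanh (path s i) * (θ' i - θ i)) / √(1 + u s ^ 2)) := by
      simp only [hu, smul_eq_mul]
      ring
    rw [e, norm_neg, Real.norm_eq_abs, abs_div, abs_of_pos hw, div_le_iff₀ hw, abs_mul,
      abs_of_nonneg hus]
    calc u s * |∑ i, Real.tanh (path s i) * (θ' i - θ i)|
        ≤ u s * ((∑ i, |Real.tanh (path s i)|) * δ) := mul_le_mul_of_nonneg_left hsum hus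
      _ = (∑ i, |Real.tanh (path s i)|) * u s * δ := by ring
      _ ≤ √(rateSq (Fintype.card ι) lam) * √(1 + u s ^ 2) * δ :=
          mul_le_mul_of_nonneg_right hrate hδ0
      _ = _ := by ring
  have h := norm_image_sub_le_of_norm_deriv_le_segment_01'
    (fun s _ => (hderiv s).hasDerivWithinAt) (fun s _ => hbound s)
  simpa [hpath] using h

/-- The coordinate in which the cavity recursion contracts. -/
noncomputable def angle (p : ℝ) : ℝ := Real.arsinh (√(p⁻¹ - 1))

theorem sq_cosh_angle {p : ℝ} (hp0 : 0 < p) (hp1 : p ≤ 1) : Real.cosh (angle p) ^ 2 = p⁻¹ := by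
  have h : 0 ≤ p⁻¹ - 1 := sub_nonneg.2 ((one_le_inv₀ hp0).2 hp1)
  rw [angle, Real.cosh_arsinh, Real.sq_sqrt (by positivity), Real.sq_sqrt h]
  ring

theorem inv_cosh_angle {p : ℝ} (hp0 : 0 < p) (hp1 : p ≤ 1) :
    (Real.cosh (angle p))⁻¹ = √p := by
  rw [← Real.sqrt_sq (inv_pos.2 (Real.cosh_pos (angle p))).le, inv_pow, sq_cosh_angle hp0 hp1,
    inv_inv]

/-- `log p = -2 log cosh (angle p)`, and `log cosh` is 1-Lipschitz because its derivative is `tanh`.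
-/
theorem abs_log_sub_le_angle {p q : ℝ} (hp0 : 0 < p) (hp1 : p ≤ 1) (hq0 : 0 < q) (hq1 : q ≤ 1) :
    |Real.log p - Real.log q| ≤ 2 * |angle p - angle q| := by
  have key : ∀ {p : ℝ}, 0 < p → p ≤ 1 →
      Real.log p = -(2 * Real.log (Real.cosh (angle p))) := by
    intro p h0 h1
    have := congrArg Real.log (sq_cosh_angle h0 h1)
    rw [Real.log_pow, Real.log_inv] at this
    push_cast at this
    linarith
  rw [key hp0 hp1, key hq0 hq1]
  have h := abs_log_cosh_sub_le (angle q) (angle p)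
  rw [show -(2 * Real.log (Real.cosh (angle p))) - -(2 * Real.log (Real.cosh (angle q)))
    = 2 * (Real.log (Real.cosh (angle q)) - Real.log (Real.cosh (angle p))) by ring, abs_mul,
    abs_of_pos (two_pos : (0 : ℝ) < 2), abs_sub_comm (angle p)]
  linarith

theorem abs_angle_sub_le {lam : ℝ} (hlam : 0 < lam) {p q : ℝ}
    (hp0 : (1 + lam)⁻¹ ≤ p) (hp1 : p ≤ 1) (hq0 : (1 + lam)⁻¹ ≤ q) (hq1 : q ≤ 1) :
    |angle p - angle q| ≤ Real.arsinh (√lam) := by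
  have key : ∀ {p : ℝ}, (1 + lam)⁻¹ ≤ p → p ≤ 1 → 0 ≤ angle p ∧ angle p ≤ Real.arsinh (√lam) := by
    intro p h0 h1
    refine ⟨Real.arsinh_nonneg_iff.2 (Real.sqrt_nonneg _), ?_⟩
    refine Real.arsinh_le_arsinh.2 (Real.sqrt_le_sqrt ?_)
    have := inv_le_of_inv_le₀ (by linarith) h0
    linarith
  have h1 := key hp0 hp1
  have h2 := key hq0 hq1
  rw [abs_le]
  constructor <;> linarith [h1.1, h1.2, h2.1, h2.2]

/-- If `p'` is the new value then `1 / p' - 1 = lam * ∏ p i`, whose square root is `√lam * ∏ 1 /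
cosh (angle (p i))`. -/
theorem angle_cavity {ι : Type*} [Fintype ι] {lam : ℝ} (hlam : 0 < lam) (p : ι → ℝ)
    (hp0 : ∀ i, 0 < p i) (hp1 : ∀ i, p i ≤ 1) :
    angle (1 / (1 + lam * ∏ i, p i)) = angleMap lam fun i => angle (p i) := by
  unfold angleMap
  rw [angle]
  congr 1
  rw [one_div, inv_inv, add_sub_cancel_left, Real.sqrt_mul hlam.le]
  congr 1
  rw [Real.sqrt_eq_iff_mul_self_eq (Finset.prod_nonneg fun i _ => (hp0 i).le)
    (Finset.prod_nonneg fun i _ => (inv_pos.2 (Real.cosh_pos _)).le), ← Finset.prod_mul_distrib]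
  refine Finset.prod_congr rfl fun i _ => ?_
  rw [inv_cosh_angle (hp0 i) (hp1 i), Real.mul_self_sqrt (hp0 i).le]

/-- One step of the cavity recursion with at most `b` children contracts the angle. -/
theorem abs_angle_cavity_sub_le {b : ℕ} (hb : 2 ≤ b) {lam : ℝ} (hlam : 0 < lam)
    (hlam' : lam < (b : ℝ) ^ b / (b - 1) ^ (b + 1)) {α : Type*} (l : List α)
    (hl : l.length ≤ b) (p q : α → ℝ) (hp0 : ∀ x ∈ l, 0 < p x) (hp1 : ∀ x ∈ l, p x ≤ 1)
    (hq0 : ∀ x ∈ l, 0 < q x) (hq1 : ∀ x ∈ l, q x ≤ 1) {δ : ℝ} (hδ0 : 0 ≤ δ)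
    (hδ : ∀ x ∈ l, |angle (p x) - angle (q x)| ≤ δ) :
    |angle (1 / (1 + lam * (l.map p).prod)) - angle (1 / (1 + lam * (l.map q).prod))|
      ≤ √(rateSq b lam) * δ := by
  -- A list shorter than `b` is padded to exactly `b` factors equal to `1`. The padding is the same
  -- on both sides, so it contributes no difference of angles.
  have key : ∀ p : α → ℝ, (l.map p).prod
      = ∏ i : Fin l.length ⊕ Fin (b - l.length),
        Sum.elim (fun i : Fin l.length => p l[i]) (fun _ => 1) i := by
    intro p
    rw [Fintype.prod_sum_type]
    simp
  have hcard : Fintype.card (Fin l.length ⊕ Fin (b - l.length)) = b := by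
    simp
    omega
  have h1 : angle (1 : ℝ) = 0 := by simp [angle]
  rw [key p, key q, angle_cavity hlam, angle_cavity hlam]
  · have h := abs_angleMap_sub_le (ι := Fin l.length ⊕ Fin (b - l.length)) (by rwa [hcard]) hlam
      (by rwa [hcard])
      (fun i => angle (Sum.elim (fun i : Fin l.length => q l[i]) (fun _ => 1) i))
      (fun i => angle (Sum.elim (fun i : Fin l.length => p l[i]) (fun _ => 1) i)) hδ0 (by
        rintro (i | i)
        · exact hδ _ (List.getElem_mem _)
        · simpa using hδ0)
    rwa [hcard] at h
  · rintro (i | i)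
    · exact hq0 _ (List.getElem_mem _)
    · simp
  · rintro (i | i)
    · exact hq1 _ (List.getElem_mem _)
    · simp
  · rintro (i | i)
    · exact hp0 _ (List.getElem_mem _)
    · simp
  · rintro (i | i)
    · exact hp1 _ (List.getElem_mem _)
    · simp

/-! ### The cavity recursion on sets of nodes -/

/-- The neighbours of a node, in the order in which the algorithm visits them. -/
def neighbors {d : ℕ} (v : Node d) : List (Node d) := (listNeighbors v).val

theorem length_neighbors {d : ℕ} (v : Node d) : (neighbors v).length = 2 * d := by
  simp [neighbors, listNeighbors, mul_comm]

theorem mem_neighbors {d : ℕ} {v w : Node d} :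
    w ∈ neighbors v ↔
      ∃ i, w = Function.update v i (v i - 1) ∨ w = Function.update v i (v i + 1) := by
  simp [neighbors, listNeighbors]

theorem mem_neighbors_comm {d : ℕ} {v w : Node d} : w ∈ neighbors v ↔ v ∈ neighbors w := by
  suffices h : ∀ v w : Node d, w ∈ neighbors v → v ∈ neighbors w from ⟨h v w, h w v⟩
  intro v w h
  obtain ⟨i, rfl | rfl⟩ := mem_neighbors.1 h
  · exact mem_neighbors.2 ⟨i, Or.inr (by simp)⟩
  · exact mem_neighbors.2 ⟨i, Or.inl (by simp)⟩

theorem abs_sub_le_one_of_mem_neighbors {d : ℕ} {v w : Node d} (h : w ∈ neighbors v)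
    (i : Fin d) : |w i - v i| ≤ 1 := by
  obtain ⟨j, rfl | rfl⟩ := mem_neighbors.1 h <;>
  · rcases eq_or_ne i j with rfl | hij
    · simp
    · simp [Function.update_of_ne hij]

theorem adj_iff_mem_neighbors {d : ℕ} {v w : Node d} :
    (lattice d).Adj v w ↔ w ∈ neighbors v := by
  constructor
  · intro h
    have h : ∑ i, |v i - w i| = 1 := h
    obtain ⟨i, hi⟩ : ∃ i, v i ≠ w i := by
      by_contra! hne
      simp [hne] at h
    have hsplit := Finset.add_sum_erase Finset.univ (fun i => |v i - w i|) (Finset.mem_univ i)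
    simp only [h] at hsplit
    have hnonneg : 0 ≤ ∑ j ∈ Finset.univ.erase i, |v j - w j| :=
      Finset.sum_nonneg fun j _ => abs_nonneg _
    have hpos : 0 < |v i - w i| := abs_pos.2 (sub_ne_zero.2 hi)
    have hzero : ∑ j ∈ Finset.univ.erase i, |v j - w j| = 0 := by omega
    have hone : |v i - w i| = 1 := by omega
    have hother : ∀ j, j ≠ i → w j = v j := fun j hj => by
      have := (Finset.sum_eq_zero_iff_of_nonneg fun j _ => abs_nonneg _).1 hzero j
        (Finset.mem_erase.2 ⟨hj, Finset.mem_univ j⟩)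
      rw [abs_eq_zero] at this
      omega
    refine mem_neighbors.2 ⟨i, ?_⟩
    rcases (abs_eq zero_le_one).1 hone with h1 | h1
    · left
      funext j
      rcases eq_or_ne j i with rfl | hj
      · simp; omega
      · rw [Function.update_of_ne hj, hother j hj]
    · right
      funext j
      rcases eq_or_ne j i with rfl | hj
      · simp; omega
      · rw [Function.update_of_ne hj, hother j hj]
  · intro h
    have key : ∀ (i : Fin d) (x : ℤ), |v i - x| = 1 →
        ∑ j, |v j - Function.update v i x j| = 1 := by
      intro i x hx
      rw [Finset.sum_eq_single i]
      · simpa using hx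
      · intro j _ hj
        simp [Function.update_of_ne hj]
      · simp
    obtain ⟨i, rfl | rfl⟩ := mem_neighbors.1 h
    · exact key i _ (by simp)
    · exact key i _ (by simp)

open Classical in
/-- The subproblems of the cavity recursion: each node of the list that lies in the current graph,
paired with the current graph, and then removed from it. -/
noncomputable def children {d : ℕ} :
    List (Node d) → Set (Node d) → List (Set (Node d) × Node d)
  | [], _ => []
  | w :: ws, V => if w ∈ V then (V, w) :: children ws (V \ {w}) else children ws V

theorem mem_children {d : ℕ} {ws : List (Node d)} {V : Set (Node d)}
    {c : Set (Node d) × Node d} (h : c ∈ children ws V) : c.2 ∈ ws ∧ c.2 ∈ c.1 ∧ c.1 ⊆ V := by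
  induction ws generalizing V with
  | nil => simp [children] at h
  | cons w ws ih =>
    rw [children] at h
    split_ifs at h with hw
    · rcases List.mem_cons.1 h with rfl | h
      · exact ⟨by simp, hw, subset_rfl⟩
      · obtain ⟨h1, h2, h3⟩ := ih h
        exact ⟨by simp [h1], h2, h3.trans Set.sdiff_subset⟩
    · obtain ⟨h1, h2, h3⟩ := ih h
      exact ⟨by simp [h1], h2, h3⟩

theorem length_children_le {d : ℕ} (ws : List (Node d)) (V : Set (Node d)) :
    (children ws V).length ≤ ws.length := by
  induction ws generalizing V with
  | nil => simp [children]
  | cons w ws ih =>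
    rw [children]
    split_ifs
    · simpa using ih _
    · exact (ih _).trans (by simp)

/-- This is what lowers the branching number from the degree `2d` to `2d - 1`, and so yields the
stated threshold for `lam`. -/
theorem length_children_lt {d : ℕ} {ws : List (Node d)} {V : Set (Node d)}
    (h : ∃ w ∈ ws, w ∉ V) : (children ws V).length < ws.length := by
  induction ws generalizing V with
  | nil => simp at h
  | cons w ws ih =>
    rw [children]
    obtain ⟨u, hu, huV⟩ := h
    split_ifs with hw
    · rcases List.mem_cons.1 hu with rfl | hu
      · exact absurd hw huV
      · simpa using ih ⟨u, hu, fun h => huV h.1⟩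
    · have := length_children_le ws V
      simp
      omega

/-- One step of the cavity recursion. -/
noncomputable def cavityStep {d : ℕ} (lam : ℝ) (f : Set (Node d) → Node d → ℝ)
    (V : Set (Node d)) (v : Node d) : ℝ :=
  1 / (1 + lam * ((children (neighbors v) (V \ {v})).map fun c => f c.1 c.2).prod)

/-- The values of `f` lie in `[x, 1]`. -/
def BoundedFrom {d : ℕ} (x : ℝ) (f : Set (Node d) → Node d → ℝ) : Prop :=
  ∀ V v, x ≤ f V v ∧ f V v ≤ 1

theorem BoundedFrom.mono {d : ℕ} {x y : ℝ} {f : Set (Node d) → Node d → ℝ}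
    (hf : BoundedFrom x f) (hyx : y ≤ x) : BoundedFrom y f :=
  fun V v => ⟨hyx.trans (hf V v).1, (hf V v).2⟩

theorem list_prod_map_mem_unit {α : Type*} (l : List α) {p : α → ℝ}
    (h : ∀ x, 0 ≤ p x ∧ p x ≤ 1) : 0 ≤ (l.map p).prod ∧ (l.map p).prod ≤ 1 := by
  induction l with
  | nil => simp
  | cons x l ih =>
    rw [List.map_cons, List.prod_cons]
    exact ⟨mul_nonneg (h x).1 ih.1, mul_le_one₀ (h x).2 ih.1 ih.2⟩

theorem list_prod_map_le {α : Type*} (l : List α) {p q : α → ℝ}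
    (h : ∀ x, 0 ≤ p x ∧ p x ≤ q x) : (l.map p).prod ≤ (l.map q).prod := by
  induction l with
  | nil => simp
  | cons x l ih =>
    rw [List.map_cons, List.prod_cons, List.map_cons, List.prod_cons]
    have hl : 0 ≤ (l.map p).prod := by
      refine List.prod_nonneg fun y hy => ?_
      obtain ⟨z, -, rfl⟩ := List.mem_map.1 hy
      exact (h z).1
    exact mul_le_mul (h x).2 ih hl ((h x).1.trans (h x).2)

section Step

variable {d : ℕ} {lam : ℝ}

theorem BoundedFrom.cavityStep (hlam : 0 < lam) {f : Set (Node d) → Node d → ℝ}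
    (hf : BoundedFrom 0 f) : BoundedFrom (1 + lam)⁻¹ (cavityStep lam f) := by
  intro V v
  obtain ⟨h0, h1⟩ := list_prod_map_mem_unit (children (neighbors v) (V \ {v}))
    (p := fun c => f c.1 c.2) fun c => hf c.1 c.2
  unfold HardCore.cavityStep
  constructor
  · rw [one_div]
    refine inv_anti₀ (by positivity) ?_
    nlinarith
  · rw [div_le_one (by positivity)]
    nlinarith

theorem BoundedFrom.iterate (hlam : 0 < lam) {f : Set (Node d) → Node d → ℝ}
    (hf : BoundedFrom 0 f) (t : ℕ) : BoundedFrom 0 ((HardCore.cavityStep lam)^[t] f) := by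
  induction t with
  | zero => exact hf
  | succ t ih =>
    rw [Function.iterate_succ_apply']
    exact (ih.cavityStep hlam).mono (by positivity)

theorem BoundedFrom.iterate' (hlam : 0 < lam) {f : Set (Node d) → Node d → ℝ}
    (hf : BoundedFrom (1 + lam)⁻¹ f) (t : ℕ) :
    BoundedFrom (1 + lam)⁻¹ ((HardCore.cavityStep lam)^[t] f) := by
  have hf0 : BoundedFrom 0 f := hf.mono (by positivity)
  cases t with
  | zero => exact hf
  | succ t =>
    rw [Function.iterate_succ_apply']
    exact (hf0.iterate hlam t).cavityStep hlam

theorem boundedFrom_one (hlam : 0 < lam) :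
    BoundedFrom (1 + lam)⁻¹ (fun (_ : Set (Node d)) _ => (1 : ℝ)) :=
  fun _ _ => ⟨inv_le_one_of_one_le₀ (by linarith), le_rfl⟩

theorem boundedFrom_zero : BoundedFrom 0 (fun (_ : Set (Node d)) _ => (0 : ℝ)) :=
  fun _ _ => ⟨le_rfl, zero_le_one⟩

theorem cavityStep_antitone (hlam : 0 < lam) {f g : Set (Node d) → Node d → ℝ}
    (hf : BoundedFrom 0 f) (hfg : ∀ V v, f V v ≤ g V v) (V : Set (Node d)) (v : Node d) :
    cavityStep lam g V v ≤ cavityStep lam f V v := by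
  unfold cavityStep
  have h0 := (list_prod_map_mem_unit (children (neighbors v) (V \ {v}))
    (p := fun c => f c.1 c.2) fun c => hf c.1 c.2).1
  have h := list_prod_map_le (children (neighbors v) (V \ {v}))
    (p := fun c => f c.1 c.2) (q := fun c => g c.1 c.2) fun c => ⟨(hf c.1 c.2).1, hfg _ _⟩
  refine one_div_le_one_div_of_le (by positivity) ?_
  nlinarith

/-- One step reverses the order, so two steps preserve it. -/
theorem iterate_two_mul_mono (hlam : 0 < lam) {f g : Set (Node d) → Node d → ℝ}
    (hf : BoundedFrom 0 f) (hg : BoundedFrom 0 g) (hfg : ∀ V v, f V v ≤ g V v) (t : ℕ) :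
    ∀ V v, (cavityStep lam)^[2 * t] f V v ≤ (cavityStep lam)^[2 * t] g V v := by
  induction t with
  | zero => exact hfg
  | succ t ih =>
    intro V v
    rw [show 2 * (t + 1) = (2 * t + 1) + 1 by ring]
    simp only [Function.iterate_succ_apply']
    exact cavityStep_antitone hlam
      (((hg.iterate hlam _).cavityStep hlam).mono (by positivity))
      (cavityStep_antitone hlam (hf.iterate hlam _) ih) V v

/-- Decay of correlations: the recursion forgets its initial values exponentially fast, at every
node that has a neighbour outside the graph. -/
theorem abs_angle_iterate_sub_le (hd : 2 ≤ d) (hlam : 0 < lam)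
    (hlam' : lam < ((2 * d - 1 : ℕ) : ℝ) ^ (2 * d - 1)
      / (((2 * d - 1 : ℕ) : ℝ) - 1) ^ (2 * d - 1 + 1))
    {f g : Set (Node d) → Node d → ℝ} (hf : BoundedFrom (1 + lam)⁻¹ f)
    (hg : BoundedFrom (1 + lam)⁻¹ g) (t : ℕ) (V : Set (Node d)) (v : Node d)
    (hv : ∃ w ∈ neighbors v, w ∉ V) :
    |angle ((cavityStep lam)^[t] f V v) - angle ((cavityStep lam)^[t] g V v)|
      ≤ √(rateSq (2 * d - 1) lam) ^ t * Real.arsinh (√lam) := by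
  have hpos : 0 < (1 + lam)⁻¹ := by positivity
  induction t generalizing V v with
  | zero =>
    simpa using abs_angle_sub_le hlam (hf V v).1 (hf V v).2 (hg V v).1 (hg V v).2
  | succ t ih =>
    rw [Function.iterate_succ_apply', Function.iterate_succ_apply', pow_succ', mul_assoc]
    have hbf := hf.iterate' hlam t
    have hbg := hg.iterate' hlam t
    refine abs_angle_cavity_sub_le (b := 2 * d - 1) (by omega) hlam hlam'
      (children (neighbors v) (V \ {v})) ?_ _ _
      (fun c _ => hpos.trans_le (hbf c.1 c.2).1) (fun c _ => (hbf c.1 c.2).2)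
      (fun c _ => hpos.trans_le (hbg c.1 c.2).1) (fun c _ => (hbg c.1 c.2).2)
      (by have := Real.arsinh_nonneg_iff.2 (Real.sqrt_nonneg lam); positivity) ?_
    · obtain ⟨w, hw, hwV⟩ := hv
      have := length_children_lt (ws := neighbors v) (V := V \ {v}) ⟨w, hw, fun h => hwV h.1⟩
      rw [length_neighbors] at this
      omega
    -- The graph of a child no longer contains its parent `v`, so the hypothesis of a missing
    -- neighbour is inherited.
    · intro c hc
      obtain ⟨h1, -, h3⟩ := mem_children hc
      exact ih c.1 c.2 ⟨v, mem_neighbors_comm.1 h1, fun h => (h3 h).2 rfl⟩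

theorem abs_log_iterate_sub_le (hd : 2 ≤ d) (hlam : 0 < lam)
    (hlam' : lam < ((2 * d - 1 : ℕ) : ℝ) ^ (2 * d - 1)
      / (((2 * d - 1 : ℕ) : ℝ) - 1) ^ (2 * d - 1 + 1))
    {f g : Set (Node d) → Node d → ℝ} (hf : BoundedFrom (1 + lam)⁻¹ f)
    (hg : BoundedFrom (1 + lam)⁻¹ g) (t : ℕ) (V : Set (Node d)) (v : Node d)
    (hv : ∃ w ∈ neighbors v, w ∉ V) :
    |Real.log ((cavityStep lam)^[t] f V v) - Real.log ((cavityStep lam)^[t] g V v)|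
      ≤ 2 * Real.arsinh (√lam) * √(rateSq (2 * d - 1) lam) ^ t := by
  have hpos : 0 < (1 + lam)⁻¹ := by positivity
  have hbf := hf.iterate' hlam t V v
  have hbg := hg.iterate' hlam t V v
  have h1 := abs_log_sub_le_angle (hpos.trans_le hbf.1) hbf.2 (hpos.trans_le hbg.1) hbg.2
  have h2 := abs_angle_iterate_sub_le hd hlam hlam' hf hg t V v hv
  linarith

end Step

/-! ### Locality and translation invariance -/

/-- The graph `V` around `v` and the second graph around the second node agree up to
sup-distance `t`. -/
def AgreeNear {d : ℕ} (t : ℕ) (V : Set (Node d)) (v : Node d) (V' : Set (Node d))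
    (v' : Node d) : Prop :=
  ∀ u : Node d, (∀ i, |u i| ≤ t) → (v + u ∈ V ↔ v' + u ∈ V')

theorem neighbors_add {d : ℕ} (v a : Node d) :
    neighbors (v + a) = (neighbors v).map (· + a) := by
  simp only [neighbors, listNeighbors, List.map_flatMap]
  congr 1
  funext i
  simp only [List.map_cons, List.map_nil, List.cons.injEq, and_true]
  constructor <;>
  · funext j
    rcases eq_or_ne j i with rfl | hj
    · simp; ring
    · simp [Function.update_of_ne hj]

/-- Removing a neighbour deletes the same relative position from both graphs, so the agreement
persists along the list; recentring at a neighbour costs one unit of radius. -/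
theorem prod_children_congr {d : ℕ} {t : ℕ} {f : Set (Node d) → Node d → ℝ}
    (hf : ∀ V v V' v', AgreeNear t V v V' v' → f V v = f V' v') (v v' : Node d)
    (us : List (Node d)) (hus : ∀ u ∈ us, ∀ i, |u i| ≤ 1) (V V' : Set (Node d))
    (h : AgreeNear (t + 1) V v V' v') :
    ((children (us.map (v + ·)) V).map fun c => f c.1 c.2).prod
      = ((children (us.map (v' + ·)) V').map fun c => f c.1 c.2).prod := by
  induction us generalizing V V' with
  | nil => simp [children]
  | cons u us ih =>
    have hu1 : ∀ i, |u i| ≤ 1 := hus u (by simp)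
    have hu : v + u ∈ V ↔ v' + u ∈ V' := h u fun i => (hu1 i).trans (by push_cast; omega)
    rw [List.map_cons, List.map_cons, children, children]
    by_cases hV : v + u ∈ V
    · rw [if_pos hV, if_pos (hu.1 hV)]
      simp only [List.map_cons, List.prod_cons]
      congr 1
      · refine hf _ _ _ _ fun w hw => ?_
        rw [add_assoc, add_assoc]
        refine h _ fun i => ?_
        rw [Pi.add_apply]
        have := abs_add_le (u i) (w i)
        have := hu1 i
        have := hw i
        push_cast
        omega
      · refine ih (fun w hw => hus w (by simp [hw])) _ _ fun w hw => ?_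
        simp only [Set.mem_sdiff, Set.mem_singleton_iff, add_right_inj, h w hw]
    · rw [if_neg hV, if_neg fun h' => hV (hu.2 h')]
      exact ih (fun w hw => hus w (by simp [hw])) _ _ h

theorem cavityStep_congr {d : ℕ} (lam : ℝ) {t : ℕ} {f : Set (Node d) → Node d → ℝ}
    (hf : ∀ V v V' v', AgreeNear t V v V' v' → f V v = f V' v') {V V' : Set (Node d)}
    {v v' : Node d} (h : AgreeNear (t + 1) V v V' v') :
    cavityStep lam f V v = cavityStep lam f V' v' := by
  have hn : ∀ v : Node d, neighbors v = (neighbors (0 : Node d)).map (v + ·) := fun v => by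
    rw [← zero_add v, neighbors_add]
    simp [add_comm]
  unfold cavityStep
  rw [hn v, hn v', prod_children_congr hf v v' (neighbors 0) ?_ _ (V' \ {v'})]
  · intro u hu
    simp only [Set.mem_sdiff, Set.mem_singleton_iff, add_eq_left, h u hu]
  · intro u hu i
    simpa using abs_sub_le_one_of_mem_neighbors hu i

theorem iterate_congr {d : ℕ} (lam x : ℝ) (t : ℕ) {V V' : Set (Node d)}
    {v v' : Node d} (h : AgreeNear t V v V' v') :
    (cavityStep lam)^[t] (fun _ _ => x) V v = (cavityStep lam)^[t] (fun _ _ => x) V' v' := by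
  induction t generalizing V v V' v' with
  | zero => rfl
  | succ t ih =>
    rw [Function.iterate_succ_apply']
    exact cavityStep_congr lam (fun _ _ _ _ => ih) h

/-! ### The values computed by the algorithm -/

section Bind

variable {α β : Type}

theorem bind_val (x : Timed α) (f : α → Timed β) : (x >>= f).val = (f x.val).val := rfl

theorem bind_cost (x : Timed α) (f : α → Timed β) :
    (x >>= f).cost = x.cost + (f x.val).cost := rfl

theorem pure_val (x : α) : (pure x : Timed α).val = x := rfl

theorem pure_cost (x : α) : (pure x : Timed α).cost = 0 := rfl

end Bind

theorem testMem_val {d : ℕ} (w : Node d) (l : List (Node d)) :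
    (testMem w l).val = decide (w ∈ l) := by
  induction l with
  | nil => simp [testMem, bind_val, pure_val]
  | cons u l ih =>
    simp only [testMem, bind_val]
    split_ifs with h
    · simp [pure_val, h]
    · rw [ih]
      simp [Ne.symm h]

theorem diff_setOf_mem_cons {α : Type*} (s : Set α) (a : α) (l : List α) :
    s \ {u | u ∈ a :: l} = (s \ {u | u ∈ l}) \ {a} := by
  ext u
  simp only [Set.mem_sdiff, Set.mem_ofPred_eq, List.mem_cons, Set.mem_singleton_iff]
  tauto

/-- Links the list of removed nodes kept by the algorithm to the shrinking set in `children`: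
consing a node onto the list deletes it from the set. -/
theorem childProduct_val {d : ℕ} (D : Domain d) (child : List (Node d) → Node d → Timed ℝ)
    (f : Set (Node d) → Node d → ℝ)
    (hf : ∀ removed v, (child removed v).val = f (D.cavityNodes \ {u | u ∈ removed}) v)
    (ws removed : List (Node d)) :
    (childProduct D child ws removed).val
      = ((children ws (D.cavityNodes \ {u | u ∈ removed})).map fun c => f c.1 c.2).prod := by
  induction ws generalizing removed with
  | nil => simp [childProduct, children, bind_val, pure_val]
  | cons w ws ih =>
    simp only [childProduct, children, bind_val, testMem_val, testRegion]
    by_cases hw : w ∈ D.cavityNodes \ {u | u ∈ removed}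
    · rw [if_pos (by simpa using hw), if_pos hw]
      simp only [bind_val, Timed.mul, hf, ih, List.map_cons, List.prod_cons, diff_setOf_mem_cons]
    · rw [if_neg (by simpa using hw), if_neg hw]
      exact ih removed

theorem cavity_val {d : ℕ} (D : Domain d) (lam x₀ : ℝ) (t : ℕ) (removed : List (Node d))
    (v : Node d) :
    (cavity D lam x₀ t removed v).val
      = (cavityStep lam)^[t] (fun _ _ => x₀) (D.cavityNodes \ {u | u ∈ removed}) v := by
  induction t generalizing removed v with
  | zero => simp [cavity, bind_val, pure_val]
  | succ t ih =>
    rw [Function.iterate_succ_apply', cavityStep]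
    simp only [cavity, bind_val, Timed.mul, Timed.add, Timed.div]
    rw [childProduct_val D _ _ ih]
    rw [diff_setOf_mem_cons]
    rfl

theorem logCavity_val {d : ℕ} (D : Domain d) (lam x₀ : ℝ) (t : ℕ) :
    (logCavity D lam x₀ t).val
      = Real.log ((cavityStep lam)^[t] (fun _ _ => x₀) D.cavityNodes 0) := by
  simp only [logCavity, bind_val, Timed.log, cavity_val]
  simp

/-! ### The running time -/

theorem testMem_cost_le {d : ℕ} (w : Node d) (l : List (Node d)) :
    (testMem w l).cost ≤ (d + 1) * l.length + 1 := by
  induction l with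
  | nil => simp [testMem, bind_cost, pure_cost, Timed.spend]
  | cons u l ih =>
    simp only [testMem, bind_cost, Timed.spend, List.length_cons]
    split_ifs
    · simp only [pure_cost]
      nlinarith
    · nlinarith

/-- `n` bounds the length of the removed list throughout, because each candidate lengthens it by at
most one; every membership test is charged for that length. -/
theorem childProduct_cost_le {d : ℕ} (D : Domain d) (child : List (Node d) → Node d → Timed ℝ)
    (n B : ℕ) (hB : ∀ removed v, removed.length ≤ n → (child removed v).cost ≤ B)
    (ws removed : List (Node d)) (h : removed.length + ws.length ≤ n) :
    (childProduct D child ws removed).cost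
      ≤ 1 + ws.length * (2 * d + 5 + (d + 1) * n + B) := by
  induction ws generalizing removed with
  | nil => simp [childProduct, bind_cost, pure_cost, Timed.spend]
  | cons w ws ih =>
    rw [List.length_cons] at h
    have htest := testMem_cost_le w removed
    have hlen : (d + 1) * removed.length ≤ (d + 1) * n := Nat.mul_le_mul_left _ (by omega)
    simp only [childProduct, bind_cost, Timed.spend, testRegion, List.length_cons]
    rw [add_mul, one_mul]
    split_ifs
    · have h1 := hB removed w (by omega)
      have h2 := ih (w :: removed) (by rw [List.length_cons]; omega)
      simp only [bind_cost, Timed.mul]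
      omega
    · have h2 := ih removed (by omega)
      omega

/-- The growth rate of the running time of the cavity recursion. -/
def costRate (d : ℕ) : ℕ := 24 * (d + 1) ^ 3

/-- The bound must carry the length of the removed list, since that list is searched. One level
makes at most `2d` calls and lengthens the list by at most `2d + 1`, multiplying the factor
`removed.length + 1` by at most `2 (d + 1)`; `costRate` is large enough to absorb both and the
overhead. -/
theorem cavity_cost_le {d : ℕ} (D : Domain d) (lam x₀ : ℝ) (t : ℕ) (removed : List (Node d))
    (v : Node d) :
    (cavity D lam x₀ t removed v).cost ≤ costRate d ^ (t + 1) * (removed.length + 1) := by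
  have hK : 1 ≤ costRate d := by
    have : 1 ≤ (d + 1) ^ 3 := Nat.one_le_pow _ _ (by omega)
    unfold costRate
    omega
  induction t generalizing removed v with
  | zero =>
    simp only [cavity, bind_cost, pure_cost, Timed.spend, zero_add, pow_one]
    exact Nat.mul_le_mul hK (Nat.le_add_left 1 _)
  | succ t ih =>
    simp only [cavity, bind_cost, Timed.spend, Timed.mul, Timed.add, Timed.div]
    have hc := childProduct_cost_le D (cavity D lam x₀ t) (removed.length + 1 + 2 * d)
      (costRate d ^ (t + 1) * (removed.length + 1 + 2 * d + 1))
      (fun r w hr => (ih r w).trans (Nat.mul_le_mul_left _ (by omega)))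
      (neighbors v) (v :: removed) (by rw [length_neighbors, List.length_cons])
    rw [length_neighbors] at hc
    change 1 + ((2 * d * (d + 2) + 1) + ((childProduct D (cavity D lam x₀ t) (neighbors v)
      (v :: removed)).cost + (1 + (1 + 1)))) ≤ _
    have hX : 1 ≤ costRate d ^ (t + 1) := Nat.one_le_pow _ _ hK
    rw [pow_succ (costRate d) (t + 1)]
    set X := costRate d ^ (t + 1)
    set R := removed.length + 1 with hR
    have hR1 : 1 ≤ R := by omega
    have e1 : R + 2 * d + 1 ≤ 2 * (d + 1) * R := by nlinarith
    have hRX : R ≤ X * R := Nat.le_mul_of_pos_left _ hX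
    have e3 : 2 * d * (2 * d + 5 + (d + 1) * (R + 2 * d) + X * (R + 2 * d + 1))
        ≤ 2 * d * (2 * d + 5 + (d + 1) * (2 * (d + 1) * (X * R)) + 2 * (d + 1) * (X * R)) := by
      refine Nat.mul_le_mul_left _ ?_
      have h1 : R + 2 * d ≤ 2 * (d + 1) * (X * R) :=
        (by omega : R + 2 * d ≤ R + 2 * d + 1).trans (e1.trans (Nat.mul_le_mul_left _ hRX))
      have h2 : X * (R + 2 * d + 1) ≤ 2 * (d + 1) * (X * R) := by
        calc X * (R + 2 * d + 1) ≤ X * (2 * (d + 1) * R) := Nat.mul_le_mul_left _ e1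
          _ = _ := by ring
      have h3 := Nat.mul_le_mul_left (d + 1) h1
      omega
    set Y := X * R with hY
    have hY1 : 1 ≤ Y := hR1.trans hRX
    have e4 : X * costRate d * R = 24 * (d + 1) ^ 3 * Y := by
      rw [hY, costRate]; ring
    rw [e4]
    have e5 : 1 + ((2 * d * (d + 2) + 1) + ((1 + 2 * d * (2 * d + 5 +
        (d + 1) * (2 * (d + 1) * Y) + 2 * (d + 1) * Y)) + (1 + (1 + 1))))
        ≤ 24 * (d + 1) ^ 3 * Y := by
      clear_value Y
      obtain ⟨y, rfl⟩ := Nat.exists_eq_add_of_le hY1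
      ring_nf
      nlinarith [Nat.zero_le (d * y), Nat.zero_le (d ^ 2 * y), Nat.zero_le (d ^ 3 * y),
        Nat.zero_le (d ^ 2), Nat.zero_le (d ^ 3)]
    omega

theorem logCavity_cost_le {d : ℕ} (D : Domain d) (lam x₀ : ℝ) (t : ℕ) :
    (logCavity D lam x₀ t).cost ≤ costRate d ^ (t + 1) + 1 := by
  have := cavity_cost_le D lam x₀ t [] 0
  simp only [logCavity, bind_cost, Timed.log]
  simpa using this

theorem sum_cost_le {ι : Type} (f : ι → Timed ℝ) (l : List ι) (B : ℕ)
    (hB : ∀ i ∈ l, (f i).cost ≤ B) : (Timed.sum f l).cost ≤ 1 + l.length * (B + 2) := by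
  induction l with
  | nil => simp [Timed.sum, bind_cost, pure_cost, Timed.spend]
  | cons i l ih =>
    have h1 := hB i (by simp)
    have h2 := ih fun j hj => hB j (by simp [hj])
    simp only [Timed.sum, bind_cost, Timed.spend, Timed.add, List.length_cons]
    rw [add_mul, one_mul]
    omega

theorem prod_cost_le {ι : Type} (f : ι → Timed ℝ) (l : List ι) (B : ℕ)
    (hB : ∀ i ∈ l, (f i).cost ≤ B) : (Timed.prod f l).cost ≤ 1 + l.length * (B + 2) := by
  induction l with
  | nil => simp [Timed.prod, bind_cost, pure_cost, Timed.spend]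
  | cons i l ih =>
    have h1 := hB i (by simp)
    have h2 := ih fun j hj => hB j (by simp [hj])
    simp only [Timed.prod, bind_cost, Timed.spend, Timed.mul, List.length_cons]
    rw [add_mul, one_mul]
    omega

theorem sum_val {ι : Type} (f : ι → Timed ℝ) (l : List ι) :
    (Timed.sum f l).val = (l.map fun i => (f i).val).sum := by
  induction l with
  | nil => simp [Timed.sum, bind_val, pure_val]
  | cons i l ih => simp [Timed.sum, bind_val, Timed.add, ih]

theorem prod_val {ι : Type} (f : ι → Timed ℝ) (l : List ι) :
    (Timed.prod f l).val = (l.map fun i => (f i).val).prod := by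
  induction l with
  | nil => simp [Timed.prod, bind_val, pure_val]
  | cons i l ih => simp [Timed.prod, bind_val, Timed.mul, ih]

theorem computeFaceArea_val {d : ℕ} (a : Fin d → ℝ) (j : Fin d) :
    (computeFaceArea a j).val = faceArea a j := by
  rw [computeFaceArea, prod_val, faceArea, ← Fin.prod_univ_def,
    ← Finset.mul_prod_erase Finset.univ _ (Finset.mem_univ j)]
  simp only [bind_val, if_true, pure_val, one_mul]
  refine Finset.prod_congr rfl fun k hk => ?_
  rw [if_neg (Finset.ne_of_mem_erase hk)]
  rfl

theorem computeFaceArea_cost_le {d : ℕ} (a : Fin d → ℝ) (j : Fin d) :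
    (computeFaceArea a j).cost ≤ 1 + d * 4 := by
  have h := prod_cost_le (fun k => do
    Timed.spend 1
    if k = j then return 1 else Timed.mul 2 (a k)) (List.finRange d) 2 (by
      intro k _
      simp only [bind_cost, Timed.spend]
      split_ifs
      · simp [pure_cost]
      · simp [Timed.mul])
  simpa [computeFaceArea] using h

theorem scaFreeEnergy_cost_le (d : ℕ) (lam : ℝ) (c : ℕ) (ε : ℝ) :
    (scaFreeEnergy d lam c ε).cost ≤ (level c ε).cost + 5
      + 2 * costRate d ^ (2 * (level c ε).val + 1) := by
  have h1 := logCavity_cost_le (Domain.whole : Domain d) lam 1 (2 * (level c ε).val)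
  have h2 := logCavity_cost_le (Domain.whole : Domain d) lam 0 (2 * (level c ε).val)
  simp only [scaFreeEnergy, bind_cost, Timed.spend, Timed.sub, pure_cost]
  omega

theorem scaSurfacePressure_cost_le (d : ℕ) (lam : ℝ) (a : Fin d → ℝ) (c : ℕ) (ε : ℝ) :
    (scaSurfacePressure d lam a c ε).cost ≤ (level c ε).cost
      + 1 + (costRate d ^ (2 * (level c ε).val + 1) + 1) + (1 + d * (3 + d * 4))
      + (1 + d * (6 + d * 4
        + (level c ε).val * (2 * costRate d ^ (2 * (level c ε).val + 1) + 7))) := by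
  have h1 := logCavity_cost_le (Domain.whole : Domain d) lam 1 (2 * (level c ε).val)
  simp only [scaSurfacePressure, bind_cost, Timed.spend]
  have h2 := sum_cost_le (computeFaceArea a) (List.finRange d) (1 + d * 4)
    fun j _ => computeFaceArea_cost_le a j
  rw [List.length_finRange] at h2
  have h3 := fun (F : Fin d → Timed ℝ) (B : ℕ) (hF : ∀ j, (F j).cost ≤ B) =>
    sum_cost_le F (List.finRange d) B fun j _ => hF j
  simp only [List.length_finRange] at h3
  have e1 : 1 + d * (1 + d * 4 + 2) = 1 + d * (3 + d * 4) := by ring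
  rw [e1] at h2
  rw [add_assoc, add_assoc, add_assoc]
  refine Nat.add_le_add_left (Nat.add_le_add_left (Nat.add_le_add h1 (Nat.add_le_add h2 ?_)) _) _
  refine (h3 _ (4 + d * 4
    + (level c ε).val * (2 * costRate d ^ (2 * (level c ε).val + 1) + 7)) ?_).trans
      (le_of_eq (by ring))
  intro j
  have h4 := computeFaceArea_cost_le a j
  simp only [bind_cost, Timed.div, Timed.mul]
  have h5 := sum_cost_le (fun k => do
      let up ← logCavity (Domain.upper j k) lam 1 (2 * (level c ε).val)
      let low ← logCavity (Domain.lower j k) lam 1 (2 * (level c ε).val)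
      let z ← Timed.mul 2 (logCavity (Domain.whole : Domain d) lam 1 (2 * (level c ε).val)).val
      let z' ← Timed.sub z up
      Timed.sub z' low) (List.range (level c ε).val)
      (2 * costRate d ^ (2 * (level c ε).val + 1) + 5) (by
        intro k _
        have g1 := logCavity_cost_le (Domain.upper j k) lam 1 (2 * (level c ε).val)
        have g2 := logCavity_cost_le (Domain.lower j k) lam 1 (2 * (level c ε).val)
        simp only [bind_cost, Timed.sub, Timed.mul]
        omega)
  rw [List.length_range] at h5
  simp only [Timed.mul] at h5
  change _ ≤ 1 + _ * (_ + 7) at h5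
  omega

/-! ### Marginals of the finite model -/

section Finite

variable {d : ℕ} {lam : ℝ}

theorem isIndepSet_insert_iff [DecidableEq (Node d)] {v : Node d} {I : Finset (Node d)}
    (hv : v ∉ I) :
    (lattice d).IsIndepSet (↑(insert v I) : Set (Node d)) ↔
      (lattice d).IsIndepSet (↑I : Set (Node d)) ∧ ∀ u ∈ I, u ∉ neighbors v := by
  rw [Finset.coe_insert, SimpleGraph.IsIndepSet, SimpleGraph.IsIndepSet, Set.pairwise_insert]
  refine and_congr_right fun _ => forall₂_congr fun u hu => ?_
  have hne : v ≠ u := fun h => hv (h ▸ hu)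
  simp only [hne, ne_eq, not_false_eq_true, true_imp_iff, adj_iff_mem_neighbors,
    mem_neighbors_comm (v := u), and_self]

open Classical in
-- Independent sets are split according to whether they contain `v`; those that do avoid its
-- neighbours.
theorem partitionFunction_insert (lam : ℝ) {v : Node d} {Λ : Finset (Node d)} (hv : v ∉ Λ) :
    partitionFunction d lam (insert v Λ) = partitionFunction d lam Λ
      + lam * partitionFunction d lam (Λ.filter (· ∉ neighbors v)) := by
  unfold partitionFunction
  rw [Finset.sum_filter, Finset.sum_powerset_insert hv, ← Finset.sum_filter]
  congr 1
  rw [Finset.mul_sum, ← Finset.sum_filter]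
  refine Finset.sum_congr ?_ ?_
  · ext I
    have hsub : I ⊆ Λ.filter (· ∉ neighbors v) ↔ I ⊆ Λ ∧ ∀ u ∈ I, u ∉ neighbors v := by
      simp only [Finset.subset_iff, Finset.mem_filter]
      exact forall₂_and
    simp only [Finset.mem_filter, Finset.mem_powerset, hsub]
    constructor
    · rintro ⟨h1, h2⟩
      rw [isIndepSet_insert_iff fun h => hv (h1 h)] at h2
      exact ⟨⟨h1, h2.2⟩, h2.1⟩
    · rintro ⟨⟨h1, h2⟩, h3⟩
      rw [isIndepSet_insert_iff fun h => hv (h1 h)]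
      exact ⟨h1, h3, h2⟩
  · intro I hI
    have : I ⊆ Λ := (Finset.mem_powerset.1 (Finset.mem_filter.1 hI).1).trans
      (Finset.filter_subset _ _)
    rw [Finset.card_insert_of_notMem fun h => hv (this h), pow_succ']

theorem partitionFunction_pos (hlam : 0 < lam) (Λ : Finset (Node d)) :
    0 < partitionFunction d lam Λ := by
  classical
  unfold partitionFunction
  refine Finset.sum_pos (fun I _ => pow_pos hlam _) ⟨∅, ?_⟩
  simp [SimpleGraph.IsIndepSet]

theorem partitionFunction_empty : partitionFunction d lam ∅ = 1 := by
  classical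
  unfold partitionFunction
  rw [Finset.powerset_empty, Finset.filter_true_of_mem]
  · simp
  · simp [SimpleGraph.IsIndepSet]

open Classical in
/-- The partition function of a finite set of nodes, extended by `1` to infinite sets. -/
noncomputable def setPartition (lam : ℝ) (V : Set (Node d)) : ℝ :=
  if h : V.Finite then partitionFunction d lam h.toFinset else 1

theorem setPartition_coe (lam : ℝ) (Λ : Finset (Node d)) :
    setPartition lam (Λ : Set (Node d)) = partitionFunction d lam Λ := by
  rw [setPartition, dif_pos Λ.finite_toSet]
  simp

theorem setPartition_pos (hlam : 0 < lam) (V : Set (Node d)) : 0 < setPartition lam V := by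
  unfold setPartition
  split_ifs
  · exact partitionFunction_pos hlam _
  · exact one_pos

theorem setPartition_eq_add (lam : ℝ) {V : Set (Node d)} (hV : V.Finite) {v : Node d}
    (hv : v ∈ V) :
    setPartition lam V = setPartition lam (V \ {v})
      + lam * setPartition lam ((V \ {v}) \ {u | u ∈ neighbors v}) := by
  classical
  obtain ⟨Λ, rfl⟩ := hV.exists_finset_coe
  have e1 : (Λ : Set (Node d)) \ {v} = ↑(Λ.erase v) := by simp
  have e2 : (↑(Λ.erase v) : Set (Node d)) \ {u | u ∈ neighbors v}
      = ↑((Λ.erase v).filter (· ∉ neighbors v)) := by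
    ext u
    simp [and_comm]
  rw [e1, e2, setPartition_coe, setPartition_coe, setPartition_coe,
    ← partitionFunction_insert lam (Finset.notMem_erase v Λ),
    Finset.insert_erase (Finset.mem_coe.1 hv)]

/-- The probability that the node `v` is not occupied, in the model on the finite set `V`. -/
noncomputable def vacancy (lam : ℝ) (V : Set (Node d)) (v : Node d) : ℝ :=
  setPartition lam (V \ {v}) / setPartition lam V

/-- The product telescopes: the graph of each child is that of the previous child with one node
removed, and nodes outside the graph change nothing. -/
theorem prod_children_vacancy (hlam : 0 < lam) (ws : List (Node d)) (V : Set (Node d)) :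
    ((children ws V).map fun c => vacancy lam c.1 c.2).prod
      = setPartition lam (V \ {u | u ∈ ws}) / setPartition lam V := by
  induction ws generalizing V with
  | nil => simp [children, (setPartition_pos hlam V).ne']
  | cons w ws ih =>
    rw [children, diff_setOf_mem_cons, sdiff_right_comm]
    split_ifs with hw
    · rw [List.map_cons, List.prod_cons, ih, vacancy]
      have h1 := (setPartition_pos hlam V).ne'
      have h2 := (setPartition_pos hlam (V \ {w})).ne'
      field_simp
    · rw [ih, Set.sdiff_singleton_eq_self hw]

theorem cavityStep_vacancy (hlam : 0 < lam) {V : Set (Node d)} (hV : V.Finite) {v : Node d}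
    (hv : v ∈ V) : cavityStep lam (vacancy lam) V v = vacancy lam V v := by
  have h1 := setPartition_pos hlam V
  have h2 := setPartition_pos hlam (V \ {v})
  have h3 := setPartition_pos hlam ((V \ {v}) \ {u | u ∈ neighbors v})
  rw [cavityStep, prod_children_vacancy hlam, vacancy]
  have e := setPartition_eq_add lam hV hv
  rw [eq_div_iff h1.ne', e]
  field_simp

/-- The fixed-point equation is available only for finite graphs and nodes in them, so the induction
uses that every child is again such a pair. -/
theorem iterate_vacancy (hlam : 0 < lam) (t : ℕ) {V : Set (Node d)} (hV : V.Finite) {v : Node d}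
    (hv : v ∈ V) : (cavityStep lam)^[t] (vacancy lam) V v = vacancy lam V v := by
  induction t generalizing V v with
  | zero => rfl
  | succ t ih =>
    rw [Function.iterate_succ_apply', ← cavityStep_vacancy hlam hV hv, cavityStep, cavityStep]
    congr 4
    refine List.map_congr_left fun c hc => ?_
    obtain ⟨-, h2, h3⟩ := mem_children hc
    exact ih ((hV.subset Set.sdiff_subset).subset h3) h2

theorem boundedFrom_vacancy (hlam : 0 < lam) :
    BoundedFrom (1 + lam)⁻¹ (vacancy lam : Set (Node d) → Node d → ℝ) := by
  -- `BoundedFrom` quantifies over all pairs, so the degenerate ones are settled too: there the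
  -- quotient is `1`. For the others, the bounds `0` and `1` come first, and one exact step of the
  -- recursion lifts the lower bound to `(1 + lam)⁻¹`.
  have htriv : ∀ (V : Set (Node d)) (v : Node d), ¬ (V.Finite ∧ v ∈ V) → vacancy lam V v = 1 := by
    intro V v h
    unfold vacancy
    by_cases hV : V.Finite
    · rw [Set.sdiff_singleton_eq_self fun hv => h ⟨hV, hv⟩, div_self (setPartition_pos hlam V).ne']
    · have hV' : ¬ (V \ {v}).Finite := fun h => hV (h.of_sdiff (Set.finite_singleton v))
      rw [setPartition, setPartition, dif_neg hV, dif_neg hV', div_one]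
  have h0 : BoundedFrom 0 (vacancy lam : Set (Node d) → Node d → ℝ) := by
    intro V v
    have h1 := setPartition_pos hlam V
    have h2 := setPartition_pos hlam (V \ {v})
    refine ⟨(div_pos h2 h1).le, ?_⟩
    by_cases h : V.Finite ∧ v ∈ V
    · rw [vacancy, div_le_one h1, setPartition_eq_add lam h.1 h.2]
      have h3 := setPartition_pos hlam ((V \ {v}) \ {u | u ∈ neighbors v})
      linarith [mul_pos hlam h3]
    · exact (htriv V v h).le
  intro V v
  by_cases h : V.Finite ∧ v ∈ V
  · rw [← cavityStep_vacancy hlam h.1 h.2]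
    exact h0.cavityStep hlam V v
  · rw [htriv V v h]
    exact boundedFrom_one hlam V v

end Finite

/-! ### The limit of the recursion -/

/-- The cavity recursion forgets its initial values at the rate `C κ^t`. -/
def Decay (d : ℕ) (lam C κ : ℝ) : Prop :=
  ∀ f g : Set (Node d) → Node d → ℝ, BoundedFrom (1 + lam)⁻¹ f → BoundedFrom (1 + lam)⁻¹ g →
    ∀ (t : ℕ) (V : Set (Node d)) (v : Node d), (∃ w ∈ neighbors v, w ∉ V) →
      |Real.log ((cavityStep lam)^[t] f V v) - Real.log ((cavityStep lam)^[t] g V v)| ≤ C * κ ^ t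

/-- The value `-log Φ_V(v, t)`. -/
noncomputable def energy {d : ℕ} (lam : ℝ) (V : Set (Node d)) (v : Node d) (t : ℕ) : ℝ :=
  -Real.log ((cavityStep lam)^[t] (fun _ _ => 1) V v)

/-- The limit of `-log Φ_V(v, t)` as `t` tends to infinity. -/
noncomputable def limitEnergy {d : ℕ} (lam : ℝ) (V : Set (Node d)) (v : Node d) : ℝ :=
  Filter.limUnder Filter.atTop (energy lam V v)

section Limit

variable {d : ℕ} {lam C κ : ℝ}

/-- Depth `t + s` is depth `t` started from the values at depth `s` in place of `1`, so decay
applies and the sequence is Cauchy. -/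
theorem abs_energy_add_sub_le (hlam : 0 < lam) (hdec : Decay d lam C κ) {V : Set (Node d)}
    {v : Node d} (hv : ∃ w ∈ neighbors v, w ∉ V) (t s : ℕ) :
    |energy lam V v (t + s) - energy lam V v t| ≤ C * κ ^ t := by
  have h := hdec _ _ (boundedFrom_one hlam) ((boundedFrom_one hlam).iterate' hlam s) t V v hv
  unfold energy
  rw [Function.iterate_add_apply]
  rwa [neg_sub_neg]

theorem tendsto_energy (hlam : 0 < lam) (hκ1 : κ < 1) (hdec : Decay d lam C κ)
    {V : Set (Node d)} {v : Node d} (hv : ∃ w ∈ neighbors v, w ∉ V) :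
    Filter.Tendsto (energy lam V v) Filter.atTop (nhds (limitEnergy lam V v)) := by
  refine (cauchySeq_of_le_geometric (f := energy lam V v) κ C hκ1 fun n => ?_).tendsto_limUnder
  rw [dist_comm, Real.dist_eq]
  exact abs_energy_add_sub_le hlam hdec hv n 1

theorem abs_limitEnergy_sub_le (hlam : 0 < lam) (hκ1 : κ < 1) (hdec : Decay d lam C κ)
    {V : Set (Node d)} {v : Node d} (hv : ∃ w ∈ neighbors v, w ∉ V) (t : ℕ) :
    |limitEnergy lam V v - energy lam V v t| ≤ C * κ ^ t := by
  have h := ((tendsto_energy hlam hκ1 hdec hv).comp (Filter.tendsto_add_atTop_nat t)).sub_const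
    (energy lam V v t)
  refine le_of_tendsto h.abs (Filter.Eventually.of_forall fun s => ?_)
  simp only [Function.comp_apply]
  rw [add_comm s t]
  exact abs_energy_add_sub_le hlam hdec hv t s

theorem abs_limitEnergy_sub_limitEnergy_le (hlam : 0 < lam) (hκ1 : κ < 1)
    (hdec : Decay d lam C κ) {V V' : Set (Node d)} {v v' : Node d}
    (hv : ∃ w ∈ neighbors v, w ∉ V) (hv' : ∃ w ∈ neighbors v', w ∉ V') {t : ℕ}
    (h : AgreeNear t V v V' v') :
    |limitEnergy lam V v - limitEnergy lam V' v'| ≤ 2 * C * κ ^ t := by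
  have h1 := abs_limitEnergy_sub_le hlam hκ1 hdec hv t
  have h2 := abs_limitEnergy_sub_le hlam hκ1 hdec hv' t
  have e : energy lam V v t = energy lam V' v' t := by
    unfold energy
    rw [iterate_congr lam 1 t h]
  rw [e] at h1
  rw [abs_le] at *
  constructor <;> linarith [h1.1, h1.2, h2.1, h2.2]

/-- Iterating from the exact vacancies changes nothing, and the recursion forgets its start; hence
iterates from `1` converge to the exact vacancy. -/
theorem limitEnergy_eq_log_sub (hlam : 0 < lam) (hκ0 : 0 ≤ κ) (hκ1 : κ < 1)
    (hdec : Decay d lam C κ) {V : Set (Node d)} (hV : V.Finite) {v : Node d} (hvV : v ∈ V)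
    (hv : ∃ w ∈ neighbors v, w ∉ V) :
    limitEnergy lam V v
      = Real.log (setPartition lam V) - Real.log (setPartition lam (V \ {v})) := by
  have hlim : Filter.Tendsto (energy lam V v) Filter.atTop (nhds (-Real.log (vacancy lam V v))) := by
    rw [tendsto_iff_dist_tendsto_zero]
    refine squeeze_zero (fun _ => dist_nonneg) (g := fun t => C * κ ^ t) (fun t => ?_) ?_
    · have h := hdec _ _ (boundedFrom_vacancy hlam) (boundedFrom_one hlam) t V v hv
      rw [iterate_vacancy hlam t hV hvV] at h
      rw [Real.dist_eq, energy, neg_sub_neg]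
      exact h
    · simpa using (tendsto_pow_atTop_nhds_zero_of_lt_one hκ0 hκ1).const_mul C
  rw [tendsto_nhds_unique (tendsto_energy hlam hκ1 hdec hv) hlim, vacancy,
    Real.log_div (setPartition_pos hlam _).ne' (setPartition_pos hlam _).ne']
  ring

end Limit

/-! ### The lexicographic order -/

theorem lexLT_iff {d : ℕ} {v u : Node d} : LexLT v u ↔ toColex v < toColex u := by
  constructor
  · rintro ⟨k, h1, h2⟩
    exact ⟨k, h2, h1⟩
  · rintro ⟨k, h1, h2⟩
    exact ⟨k, h2, h1⟩

/-- The nodes that precede `v` lexicographically, and `v` itself. -/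
def lexBelow {d : ℕ} (v : Node d) : Set (Node d) := {u | LexLT u v ∨ u = v}

theorem mem_lexBelow {d : ℕ} {u v : Node d} : u ∈ lexBelow v ↔ toColex u ≤ toColex v := by
  change LexLT u v ∨ u = v ↔ _
  rw [lexLT_iff, le_iff_lt_or_eq, toColex_inj]
  exact Iff.rfl

theorem add_mem_lexBelow {d : ℕ} {u v : Node d} : v + u ∈ lexBelow v ↔ u ∈ lexBelow 0 := by
  simp [lexBelow, LexLT]

theorem exists_neighbor_notMem_lexBelow {d : ℕ} (hd : 0 < d) (v : Node d) :
    ∃ w ∈ neighbors v, w ∉ lexBelow v := by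
  -- Increasing any one coordinate gives a lexicographic successor; the first coordinate is used.
  refine ⟨Function.update v ⟨0, hd⟩ (v ⟨0, hd⟩ + 1), mem_neighbors.2 ⟨_, Or.inr rfl⟩, ?_⟩
  rw [mem_lexBelow, Pi.toColex_update_le_self_iff]
  omega

theorem exists_neighbor_notMem_of_subset {d : ℕ} (hd : 0 < d) {v : Node d} {V : Set (Node d)}
    (h : V ⊆ lexBelow v) : ∃ w ∈ neighbors v, w ∉ V := by
  obtain ⟨w, hw, hwV⟩ := exists_neighbor_notMem_lexBelow hd v
  exact ⟨w, hw, fun h' => hwV (h h')⟩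

theorem cavityNodes_eq {d : ℕ} (D : Domain d) : D.cavityNodes = D.nodes ∩ lexBelow 0 := rfl

/-- The chain rule: the logarithm of the partition function is a sum over the nodes in
lexicographic order. -/
theorem log_partitionFunction_eq_sum {d : ℕ} {lam C κ : ℝ} (hd : 0 < d) (hlam : 0 < lam)
    (hκ0 : 0 ≤ κ) (hκ1 : κ < 1) (hdec : Decay d lam C κ) (Λ : Finset (Node d)) :
    Real.log (partitionFunction d lam Λ)
      = ∑ v ∈ Λ, limitEnergy lam ((Λ : Set (Node d)) ∩ lexBelow v) v := by
  classical
  -- Nodes are added in increasing order: the new largest node `a` leaves all earlier terms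
  -- unchanged, and its own term is the increment of the logarithm.
  induction Λ using Finset.induction_on_max_value (fun v : Node d => toColex v) with
  | empty => simp [partitionFunction_empty]
  | insert a s ha hmax ih =>
    rw [Finset.sum_insert ha]
    have e1 : (↑(insert a s) : Set (Node d)) ∩ lexBelow a = ↑(insert a s) := by
      refine Set.inter_eq_left.2 fun u hu => mem_lexBelow.2 ?_
      rcases Finset.mem_insert.1 (Finset.mem_coe.1 hu) with rfl | hu
      · exact le_rfl
      · exact hmax u hu
    have e2 : ∀ v ∈ s, (↑(insert a s) : Set (Node d)) ∩ lexBelow v = ↑s ∩ lexBelow v := by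
      intro v hv
      ext u
      simp only [Set.mem_inter_iff, Finset.coe_insert, Set.mem_insert_iff, Finset.mem_coe]
      constructor
      · rintro ⟨rfl | hu, h⟩
        · have := toColex_inj.1 (le_antisymm (mem_lexBelow.1 h) (hmax v hv))
          exact ⟨this ▸ hv, h⟩
        · exact ⟨hu, h⟩
      · rintro ⟨hu, h⟩
        exact ⟨Or.inr hu, h⟩
    rw [Finset.sum_congr rfl fun v hv => by rw [e2 v hv], ← ih, e1,
      limitEnergy_eq_log_sub hlam hκ0 hκ1 hdec (Finset.finite_toSet _) (by simp)
        (exists_neighbor_notMem_of_subset hd (Set.inter_eq_left.1 e1)), setPartition_coe]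
    have e3 : (↑(insert a s) : Set (Node d)) \ {a} = ↑s := by
      rw [← Finset.coe_erase, Finset.erase_insert ha]
    rw [e3, setPartition_coe]
    ring

/-! ### The free energy -/

theorem Domain.exists_neighbor_notMem {d : ℕ} (hd : 0 < d) (D : Domain d) :
    ∃ w ∈ neighbors (0 : Node d), w ∉ D.cavityNodes :=
  exists_neighbor_notMem_of_subset hd (Set.inter_subset_right : D.nodes ∩ lexBelow 0 ⊆ _)

theorem Domain.zero_mem_nodes {d : ℕ} (D : Domain d) : (0 : Node d) ∈ D.nodes := by
  cases D with
  | whole => trivial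
  | upper j k => change (0 : ℤ) ≤ k; omega
  | lower j k => change -(k : ℤ) ≤ 0; omega

/-- The limit of `-log Φ(t)` at the origin of the cavity region of `D`. -/
noncomputable def Domain.energy {d : ℕ} (lam : ℝ) (D : Domain d) : ℝ :=
  limitEnergy lam D.cavityNodes 0

section Compare

variable {d : ℕ} {lam C κ : ℝ}

theorem agreeNear_of_forall {Λ Λ' : Set (Node d)} {v v' : Node d} {t : ℕ}
    (h : ∀ u : Node d, (∀ i, |u i| ≤ t) → (v + u ∈ Λ ↔ v' + u ∈ Λ')) :
    AgreeNear t (Λ ∩ lexBelow v) v (Λ' ∩ lexBelow v') v' := by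
  intro u hu
  rw [Set.mem_inter_iff, Set.mem_inter_iff, add_mem_lexBelow, add_mem_lexBelow, h u hu]

theorem abs_limitEnergy_sub_domain_le (hd : 0 < d) (hlam : 0 < lam) (hκ1 : κ < 1)
    (hdec : Decay d lam C κ) {Λ : Set (Node d)} {v : Node d} (D : Domain d) {t : ℕ}
    (h : ∀ u : Node d, (∀ i, |u i| ≤ t) → (v + u ∈ Λ ↔ u ∈ D.nodes)) :
    |limitEnergy lam (Λ ∩ lexBelow v) v - D.energy lam| ≤ 2 * C * κ ^ t := by
  refine abs_limitEnergy_sub_limitEnergy_le hlam hκ1 hdec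
    (exists_neighbor_notMem_of_subset hd Set.inter_subset_right) (D.exists_neighbor_notMem hd) ?_
  rw [cavityNodes_eq]
  refine agreeNear_of_forall fun u hu => ?_
  rw [zero_add]
  exact h u hu

theorem abs_domain_sub_domain_le (hd : 0 < d) (hlam : 0 < lam) (hκ1 : κ < 1)
    (hdec : Decay d lam C κ) (D D' : Domain d) {t : ℕ}
    (h : ∀ u : Node d, (∀ i, |u i| ≤ t) → (u ∈ D.nodes ↔ u ∈ D'.nodes)) :
    |D.energy lam - D'.energy lam| ≤ 2 * C * κ ^ t := by
  refine abs_limitEnergy_sub_domain_le hd hlam hκ1 hdec (v := 0) D' fun u hu => ?_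
  rw [zero_add]
  exact h u hu

end Compare

/-- Move from `v + u` towards `v` one coordinate step at a time. The first node reached inside `Λ`
has its predecessor outside, so it lies in the boundary, and the displacements never grow in
sup-norm. The induction is on the `ℓ¹`-norm of `u`. -/
theorem exists_mem_boundary {d : ℕ} {Λ : Finset (Node d)} {v : Node d} (hv : v ∈ Λ) {t : ℕ}
    {u : Node d} (hu : ∀ i, |u i| ≤ t) (huΛ : v + u ∉ Λ) :
    ∃ z ∈ boundary Λ, ∀ i, |z i - v i| ≤ t := by
  classical
  induction hn : ∑ i, (u i).natAbs using Nat.strong_induction_on generalizing u with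
  | _ n ih =>
    obtain ⟨i, hi⟩ : ∃ i, u i ≠ 0 := by
      by_contra! h
      exact huΛ (by rwa [show u = 0 from funext h, add_zero])
    obtain ⟨x, hx1, hx2, hx3⟩ : ∃ x : ℤ, |x| ≤ |u i| ∧ x.natAbs < (u i).natAbs ∧
        |x - u i| = 1 := by
      rcases lt_or_gt_of_ne hi with h | h
      · exact ⟨u i + 1, by rw [abs_of_neg h, abs_le]; omega, by omega, by simp⟩
      · exact ⟨u i - 1, by rw [abs_of_pos h, abs_le]; omega, by omega, by simp⟩
    have hu' : ∀ j, |Function.update u i x j| ≤ t := by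
      intro j
      rcases eq_or_ne j i with rfl | hj
      · simpa using hx1.trans (hu j)
      · simpa [Function.update_of_ne hj] using hu j
    by_cases hmem : v + Function.update u i x ∈ Λ
    · refine ⟨_, Finset.mem_filter.2 ⟨hmem, v + u, ?_, huΛ⟩, fun j => by simpa using hu' j⟩
      change ∑ j, |(v + Function.update u i x) j - (v + u) j| = 1
      rw [Finset.sum_eq_single i]
      · simpa using hx3
      · intro j _ hj
        simp [Function.update_of_ne hj]
      · simp
    · refine ih _ ?_ hu' hmem rfl
      rw [← hn]
      refine Finset.sum_lt_sum (fun j _ => ?_) ⟨i, Finset.mem_univ i, by simpa using hx2⟩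
      rcases eq_or_ne j i with rfl | hj
      · simpa using hx2.le
      · simp [Function.update_of_ne hj]

open Classical in
/-- The nodes of `Λ` within sup-distance `t` of the complement. -/
noncomputable def nearComplement {d : ℕ} (t : ℕ) (Λ : Finset (Node d)) : Finset (Node d) :=
  Λ.filter fun v => ∃ u : Node d, (∀ i, |u i| ≤ t) ∧ v + u ∉ Λ

theorem card_nearComplement_le {d : ℕ} (t : ℕ) (Λ : Finset (Node d)) :
    (nearComplement t Λ).card ≤ (boundary Λ).card * (2 * t + 1) ^ d := by
  classical
  have hsub : nearComplement t Λ ⊆ (boundary Λ).biUnion fun z =>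
      Fintype.piFinset fun i => Finset.Icc (z i - t) (z i + t) := by
    intro v hv
    obtain ⟨hvΛ, u, hu, huΛ⟩ := Finset.mem_filter.1 hv
    obtain ⟨z, hz, h⟩ := exists_mem_boundary hvΛ hu huΛ
    refine Finset.mem_biUnion.2 ⟨z, hz, Fintype.mem_piFinset.2 fun i => ?_⟩
    have := abs_le.1 (h i)
    rw [Finset.mem_Icc]
    omega
  refine (Finset.card_le_card hsub).trans (Finset.card_biUnion_le_card_mul _ _ _ fun z _ => ?_)
  rw [Fintype.card_piFinset]
  refine le_of_eq ?_
  rw [Finset.prod_congr rfl fun i _ => show (Finset.Icc (z i - t) (z i + t)).card = 2 * t + 1 by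
    rw [Int.card_Icc]; omega]
  simp

section FreeEnergy

variable {d : ℕ} {lam C κ : ℝ}

/-- Nodes farther than `t` from the complement differ from the bulk value by at most `2 * C * κ ^
t`; the others are counted through the boundary and charged `2 * C` each. -/
theorem abs_log_partitionFunction_sub_le (hd : 0 < d) (hlam : 0 < lam) (hκ0 : 0 ≤ κ)
    (hκ1 : κ < 1) (hC : 0 ≤ C) (hdec : Decay d lam C κ) (Λ : Finset (Node d)) (t : ℕ) :
    |Real.log (partitionFunction d lam Λ) - Λ.card * (Domain.whole : Domain d).energy lam|
      ≤ Λ.card * (2 * C * κ ^ t) + (boundary Λ).card * ((2 * t + 1) ^ d * (2 * C)) := by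
  classical
  set P := (Domain.whole : Domain d).energy lam with hP
  rw [log_partitionFunction_eq_sum hd hlam hκ0 hκ1 hdec, ← nsmul_eq_mul, ← Finset.sum_const,
    ← Finset.sum_sub_distrib]
  refine (Finset.abs_sum_le_sum_abs _ _).trans ?_
  have hterm : ∀ v ∈ Λ, |limitEnergy lam ((Λ : Set (Node d)) ∩ lexBelow v) v - P|
      ≤ 2 * C * κ ^ t + if v ∈ nearComplement t Λ then 2 * C else 0 := by
    intro v hv
    have hpow : 0 ≤ 2 * C * κ ^ t := by positivity
    split_ifs with h
    -- At radius `0` agreement only says that `v` lies in `Λ`, which gives the uniform bound `2 *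
    -- C`.
    · have := abs_limitEnergy_sub_domain_le hd hlam hκ1 hdec (Λ := (Λ : Set (Node d))) (v := v)
        Domain.whole (t := 0) (fun u hu => by
          have : u = 0 := funext fun i => by simpa using hu i
          subst this
          simpa [hv] using Domain.zero_mem_nodes _)
      rw [pow_zero, mul_one] at this
      linarith
    · rw [add_zero]
      refine abs_limitEnergy_sub_domain_le hd hlam hκ1 hdec Domain.whole fun u hu => ?_
      refine iff_of_true ?_ trivial
      by_contra h'
      exact h (Finset.mem_filter.2 ⟨hv, u, hu, h'⟩)
  refine (Finset.sum_le_sum hterm).trans ?_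
  rw [Finset.sum_add_distrib, Finset.sum_const, nsmul_eq_mul, ← Finset.sum_filter,
    Finset.sum_const, nsmul_eq_mul]
  refine add_le_add_right ?_ _
  have hcard : ((Λ.filter (· ∈ nearComplement t Λ)).card : ℝ)
      ≤ (boundary Λ).card * (2 * t + 1) ^ d := by
    have : Λ.filter (· ∈ nearComplement t Λ) ⊆ nearComplement t Λ :=
      fun v hv => (Finset.mem_filter.1 hv).2
    exact_mod_cast (Finset.card_le_card this).trans (card_nearComplement_le t Λ)
  rw [← mul_assoc ((boundary Λ).card : ℝ)]
  exact mul_le_mul_of_nonneg_right hcard (by positivity)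

theorem hasFreeEnergy (hd : 0 < d) (hlam : 0 < lam) (hκ0 : 0 ≤ κ)
    (hκ1 : κ < 1) (hC : 0 ≤ C) (hdec : Decay d lam C κ) :
    HasFreeEnergy d lam ((Domain.whole : Domain d).energy lam) := by
  intro Λ hne hlim
  rw [Metric.tendsto_atTop]
  intro δ hδ
  have hpow : Filter.Tendsto (fun t => 2 * C * κ ^ t) Filter.atTop (nhds 0) := by
    simpa using (tendsto_pow_atTop_nhds_zero_of_lt_one hκ0 hκ1).const_mul (2 * C)
  obtain ⟨t, ht⟩ := (hpow.eventually_lt_const (half_pos hδ)).exists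
  have hbd := hlim.mul_const ((2 * t + 1 : ℝ) ^ d * (2 * C))
  rw [zero_mul] at hbd
  obtain ⟨N, hN⟩ := Filter.eventually_atTop.1 (hbd.eventually_lt_const (half_pos hδ))
  refine ⟨N, fun n hn => ?_⟩
  have hcard : (0 : ℝ) < (Λ n).card := by exact_mod_cast (hne n).card_pos
  have h := abs_log_partitionFunction_sub_le hd hlam hκ0 hκ1 hC hdec (Λ n) t
  have h2 := hN n hn
  rw [Real.dist_eq, div_sub' hcard.ne', abs_div, abs_of_pos hcard, div_lt_iff₀ hcard]
  rw [div_mul_eq_mul_div, div_lt_iff₀ hcard] at h2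
  refine h.trans_lt ?_
  nlinarith

/-- The even iterates bound the free energy from both sides. -/
theorem energy_two_mul_le (hd : 0 < d) (hlam : 0 < lam) (hκ1 : κ < 1) (hdec : Decay d lam C κ)
    (D : Domain d) (t : ℕ) :
    energy lam D.cavityNodes 0 (2 * t) ≤ D.energy lam := by
  refine ge_of_tendsto ((tendsto_energy hlam hκ1 hdec (D.exists_neighbor_notMem hd)).comp
    (Filter.tendsto_add_atTop_nat (2 * t))) (Filter.Eventually.of_forall fun s => ?_)
  simp only [Function.comp_apply, HardCore.energy]
  rw [add_comm s, Function.iterate_add_apply]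
  have h1 := (boundedFrom_one (d := d) hlam).iterate' hlam s
  have h2 := (h1.iterate' hlam (2 * t) D.cavityNodes 0).1
  have hpos : 0 < (1 + lam)⁻¹ := by positivity
  refine neg_le_neg (Real.log_le_log (hpos.trans_le h2) ?_)
  exact iterate_two_mul_mono hlam (h1.mono hpos.le) ((boundedFrom_one hlam).mono hpos.le)
    (fun V v => (h1 V v).2) t _ _

theorem le_neg_log_iterate_zero (hd : 0 < d) (hlam : 0 < lam) (hκ1 : κ < 1)
    (hdec : Decay d lam C κ) (D : Domain d) {t : ℕ} (ht : 0 < t) :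
    D.energy lam ≤ -Real.log ((cavityStep lam)^[2 * t] (fun _ _ => 0) D.cavityNodes 0) := by
  refine le_of_tendsto ((tendsto_energy hlam hκ1 hdec (D.exists_neighbor_notMem hd)).comp
    (Filter.tendsto_add_atTop_nat (2 * t))) (Filter.Eventually.of_forall fun s => ?_)
  simp only [Function.comp_apply, HardCore.energy]
  rw [add_comm s, Function.iterate_add_apply]
  have hpos : 0 < (1 + lam)⁻¹ := by positivity
  have h1 := ((boundedFrom_one (d := d) hlam).mono hpos.le).iterate hlam s
  refine neg_le_neg (Real.log_le_log (hpos.trans_le ?_) ?_)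
  -- Positivity of `t` matters: the start value `0` has no meaningful logarithm, but one step lifts
  -- it to at least `(1 + lam)⁻¹`.
  · obtain ⟨k, hk⟩ : ∃ k, 2 * t = k + 1 := ⟨2 * t - 1, by omega⟩
    rw [hk, Function.iterate_succ_apply']
    exact ((boundedFrom_zero.iterate hlam k).cavityStep hlam _ _).1
  · exact iterate_two_mul_mono hlam boundedFrom_zero h1 (fun V v => (h1 V v).1) t _ _

/-- The start value `0` lies outside the range where decay applies, so one step is spent on entering
it; hence the exponent `t` at depth `t + 1`. -/
theorem abs_log_iterate_zero_sub_le (hd : 0 < d) (hlam : 0 < lam) (hdec : Decay d lam C κ)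
    (D : Domain d) (t : ℕ) :
    |Real.log ((cavityStep lam)^[t + 1] (fun _ _ => 1) D.cavityNodes 0)
      - Real.log ((cavityStep lam)^[t + 1] (fun _ _ => 0) D.cavityNodes 0)| ≤ C * κ ^ t := by
  rw [Function.iterate_succ_apply, Function.iterate_succ_apply]
  have hpos : 0 < (1 + lam)⁻¹ := by positivity
  exact hdec _ _ (((boundedFrom_one hlam).mono hpos.le).cavityStep hlam)
    (boundedFrom_zero.cavityStep hlam) t _ _ (D.exists_neighbor_notMem hd)

end FreeEnergy

/-! ### Boxes and their faces -/

/-- The box `{v : |v_j| ≤ N_j for all j}`. -/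
noncomputable def box {d : ℕ} (N : Fin d → ℕ) : Finset (Node d) :=
  Fintype.piFinset fun j => Finset.Icc (-(N j : ℤ)) (N j)

theorem mem_box {d : ℕ} {N : Fin d → ℕ} {v : Node d} :
    v ∈ box N ↔ ∀ j, -(N j : ℤ) ≤ v j ∧ v j ≤ N j := by
  simp [box]

theorem card_side (n : ℕ) : (Finset.Icc (-(n : ℤ)) n).card = 2 * n + 1 := by
  rw [Int.card_Icc]
  omega

/-- The number of nodes of a section of the box orthogonal to the direction `j`. -/
noncomputable def sectionCard {d : ℕ} (N : Fin d → ℕ) (j : Fin d) : ℝ :=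
  ∏ i ∈ Finset.univ.erase j, (2 * (N i : ℝ) + 1)

theorem sectionCard_nonneg {d : ℕ} (N : Fin d → ℕ) (j : Fin d) : 0 ≤ sectionCard N j :=
  Finset.prod_nonneg fun i _ => by positivity

theorem sum_side_one (n : ℕ) : ∑ _x ∈ Finset.Icc (-(n : ℤ)) n, (1 : ℝ) = 2 * n + 1 := by
  rw [Finset.sum_const, card_side]
  simp

theorem sum_box_coord {d : ℕ} (N : Fin d → ℕ) (j : Fin d) (g : ℤ → ℝ) :
    ∑ v ∈ box N, g (v j) = sectionCard N j * ∑ x ∈ Finset.Icc (-(N j : ℤ)) (N j), g x := by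
  have h := Finset.prod_univ_sum (fun i => Finset.Icc (-(N i : ℤ)) (N i))
    (fun i x => if i = j then g x else 1)
  have hv : ∀ v : Node d, ∏ i, (if i = j then g (v i) else 1) = g (v j) := fun v => by
    rw [Finset.prod_ite_eq' Finset.univ j fun i => g (v i)]
    simp
  simp only [hv] at h
  change _ = ∑ v ∈ box N, g (v j) at h
  rw [← h, ← Finset.mul_prod_erase Finset.univ _ (Finset.mem_univ j), mul_comm]
  simp only [if_true]
  congr 1
  refine Finset.prod_congr rfl fun i hi => ?_
  simp only [if_neg (Finset.ne_of_mem_erase hi)]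
  exact sum_side_one (N i)

/-- The sum over a product set factors over coordinates; the section orthogonal to `j` already
counts the side `j'`, hence the division by its length. -/
theorem sum_box_two_coords {d : ℕ} (N : Fin d → ℕ) {j j' : Fin d} (hj : j ≠ j') (g g' : ℤ → ℝ) :
    ∑ v ∈ box N, g (v j) * g' (v j')
      = sectionCard N j * ((∑ x ∈ Finset.Icc (-(N j : ℤ)) (N j), g x)
        * (∑ x ∈ Finset.Icc (-(N j' : ℤ)) (N j'), g' x) / (2 * N j' + 1)) := by
  have h := Finset.prod_univ_sum (fun i => Finset.Icc (-(N i : ℤ)) (N i))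
    (fun i x => (if i = j then g x else 1) * (if i = j' then g' x else 1))
  have hv : ∀ v : Node d, ∏ i, ((if i = j then g (v i) else 1) * (if i = j' then g' (v i) else 1))
      = g (v j) * g' (v j') := fun v => by
    rw [Finset.prod_mul_distrib, Finset.prod_ite_eq' Finset.univ j fun i => g (v i),
      Finset.prod_ite_eq' Finset.univ j' fun i => g' (v i)]
    simp
  simp only [hv] at h
  change _ = ∑ v ∈ box N, g (v j) * g' (v j') at h
  have hmem : j' ∈ Finset.univ.erase j := Finset.mem_erase.2 ⟨hj.symm, Finset.mem_univ _⟩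
  rw [← h, ← Finset.mul_prod_erase Finset.univ _ (Finset.mem_univ j),
    ← Finset.mul_prod_erase _ _ hmem, sectionCard, ← Finset.mul_prod_erase _ _ hmem]
  have hrest : ∏ i ∈ (Finset.univ.erase j).erase j', ∑ x ∈ Finset.Icc (-(N i : ℤ)) (N i),
      ((if i = j then g x else 1) * (if i = j' then g' x else 1))
      = ∏ i ∈ (Finset.univ.erase j).erase j', (2 * (N i : ℝ) + 1) := by
    refine Finset.prod_congr rfl fun i hi => ?_
    obtain ⟨h1, h2⟩ := Finset.mem_erase.1 hi
    simp only [if_neg h1, if_neg (Finset.ne_of_mem_erase h2), mul_one]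
    exact sum_side_one (N i)
  rw [hrest]
  simp only [if_true, if_neg hj, if_neg hj.symm, mul_one, one_mul]
  have : (2 * (N j' : ℝ) + 1) ≠ 0 := by positivity
  field_simp

theorem card_box {d : ℕ} (N : Fin d → ℕ) (j : Fin d) :
    ((box N).card : ℝ) = sectionCard N j * (2 * N j + 1) := by
  have h := sum_box_coord N j fun _ => 1
  rw [sum_side_one] at h
  simpa using h

/-- The distance of a coordinate `x` of a node in `{-n, …, n}` to the upper end (for `true`) or
the lower end (for `false`). -/
def sideDepth (n : ℕ) (s : Bool) (x : ℤ) : ℕ := bif s then (n - x).toNat else (x + n).toNat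

theorem sum_sideDepth (n : ℕ) (s : Bool) (h : ℕ → ℝ) :
    ∑ x ∈ Finset.Icc (-(n : ℤ)) n, h (sideDepth n s x) = ∑ k ∈ Finset.range (2 * n + 1), h k := by
  cases s
  · refine Finset.sum_bij' (fun x _ => (x + n).toNat) (fun k _ => (k : ℤ) - n) ?_ ?_ ?_ ?_ ?_
    · intro x hx; rw [Finset.mem_Icc] at hx; rw [Finset.mem_range]; omega
    · intro k hk; rw [Finset.mem_range] at hk; rw [Finset.mem_Icc]; omega
    · intro x hx; rw [Finset.mem_Icc] at hx; omega
    · intro k hk; omega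
    · intro x hx; rfl
  · refine Finset.sum_bij' (fun x _ => (n - x).toNat) (fun k _ => (n : ℤ) - k) ?_ ?_ ?_ ?_ ?_
    · intro x hx; rw [Finset.mem_Icc] at hx; rw [Finset.mem_range]; omega
    · intro k hk; rw [Finset.mem_range] at hk; rw [Finset.mem_Icc]; omega
    · intro x hx; rw [Finset.mem_Icc] at hx; omega
    · intro k hk; omega
    · intro x hx; rfl

/-- The depth of a node below a face of the box. -/
def faceDepth {d : ℕ} (N : Fin d → ℕ) (f : Fin d × Bool) (v : Node d) : ℕ :=
  sideDepth (N f.1) f.2 (v f.1)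

theorem sum_faceDepth {d : ℕ} (N : Fin d → ℕ) (f : Fin d × Bool) (h : ℕ → ℝ) :
    ∑ v ∈ box N, h (faceDepth N f v)
      = sectionCard N f.1 * ∑ k ∈ Finset.range (2 * N f.1 + 1), h k := by
  rw [← sum_sideDepth (N f.1) f.2]
  exact sum_box_coord N f.1 fun x => h (sideDepth (N f.1) f.2 x)

/-- The half-space bounded by a face at distance `k` from the origin. -/
def faceDomain {d : ℕ} (f : Fin d × Bool) (k : ℕ) : Domain d :=
  bif f.2 then Domain.upper f.1 k else Domain.lower f.1 k

theorem mem_faceDomain_of_abs_le {d : ℕ} (f : Fin d × Bool) {k : ℕ} {u : Node d}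
    (hu : |u f.1| ≤ k) : u ∈ (faceDomain f k).nodes := by
  obtain ⟨j, _ | _⟩ := f
  · exact (abs_le.1 hu).1
  · exact (abs_le.1 hu).2

theorem add_mem_box_iff {d : ℕ} {N : Fin d → ℕ} {v : Node d} (hv : v ∈ box N) (u : Node d) :
    v + u ∈ box N ↔ ∀ f, u ∈ (faceDomain f (faceDepth N f v)).nodes := by
  rw [mem_box] at *
  constructor
  · intro h
    rintro ⟨j, _ | _⟩
    · have h1 := hv j
      have h2 := h j
      rw [Pi.add_apply] at h2
      change -(((v j + N j).toNat : ℕ) : ℤ) ≤ u j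
      omega
    · have h1 := hv j
      have h2 := h j
      rw [Pi.add_apply] at h2
      change u j ≤ (((N j - v j).toNat : ℕ) : ℤ)
      omega
  · intro h j
    have h1 := hv j
    have h2 : -(((v j + N j).toNat : ℕ) : ℤ) ≤ u j := h (j, false)
    have h3 : u j ≤ (((N j - v j).toNat : ℕ) : ℤ) := h (j, true)
    rw [Pi.add_apply]
    omega

theorem faceDepth_add_faceDepth {d : ℕ} {N : Fin d → ℕ} {v : Node d} (hv : v ∈ box N)
    {f f' : Fin d × Bool} (hne : f ≠ f') (hj : f.1 = f'.1) :
    faceDepth N f v + faceDepth N f' v = 2 * N f.1 := by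
  obtain ⟨j, s⟩ := f
  obtain ⟨j', s'⟩ := f'
  simp only at hj
  subst hj
  have h := mem_box.1 hv j
  cases s <;> cases s' <;> simp only [ne_eq, not_true_eq_false] at hne <;>
    simp only [faceDepth, sideDepth, cond_true, cond_false] <;> omega

/-- Bound for the contribution of a pair of faces, relative to the size of a section. -/
noncomputable def pairBound {d : ℕ} (x : ℝ) (N : Fin d → ℕ) (f f' : Fin d × Bool) : ℝ :=
  if f.1 = f'.1 then (2 * N f.1 + 1) * x ^ (2 * N f.1)
  else ((1 - x)⁻¹ * (1 - x)⁻¹) / (2 * N f'.1 + 1)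

theorem geom_sum_range_le {x : ℝ} (hx0 : 0 ≤ x) (hx1 : x < 1) (n : ℕ) :
    ∑ k ∈ Finset.range n, x ^ k ≤ (1 - x)⁻¹ := by
  rw [← tsum_geometric_of_lt_one hx0 hx1]
  exact (summable_geometric_of_lt_one hx0 hx1).sum_le_tsum _ fun k _ => pow_nonneg hx0 k

/-- For opposite faces the two depths add up to the side length minus one, so the summand is
constant. For faces in different directions the mass concentrates near their common edge: two
geometric series, with one more side length lost. -/
theorem sum_pow_faceDepth_le {d : ℕ} {x : ℝ} (hx0 : 0 ≤ x) (hx1 : x < 1) (N : Fin d → ℕ)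
    {f f' : Fin d × Bool} (hne : f ≠ f') :
    ∑ v ∈ box N, x ^ faceDepth N f v * x ^ faceDepth N f' v
      ≤ sectionCard N f.1 * pairBound x N f f' := by
  unfold pairBound
  split_ifs with hj
  · rw [Finset.sum_congr rfl fun v hv => by
      rw [← pow_add, faceDepth_add_faceDepth hv hne hj], Finset.sum_const, nsmul_eq_mul,
      card_box N f.1, mul_assoc]
  · have h := sum_box_two_coords N hj (fun y => x ^ sideDepth (N f.1) f.2 y)
      (fun y => x ^ sideDepth (N f'.1) f'.2 y)
    rw [sum_sideDepth _ _ fun k => x ^ k, sum_sideDepth _ _ fun k => x ^ k] at h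
    refine h.le.trans (mul_le_mul_of_nonneg_left ?_ (sectionCard_nonneg N f.1))
    refine div_le_div_of_nonneg_right ?_ (by positivity)
    exact mul_le_mul (geom_sum_range_le hx0 hx1 _) (geom_sum_range_le hx0 hx1 _)
      (Finset.sum_nonneg fun k _ => pow_nonneg hx0 k) (inv_nonneg.2 (by linarith))

/-! ### The surface pressure -/

/-- The excess energy at depth `k` below a face. -/
noncomputable def faceExcess {d : ℕ} (lam : ℝ) (f : Fin d × Bool) (k : ℕ) : ℝ :=
  (faceDomain f k).energy lam - (Domain.whole : Domain d).energy lam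

section Surface

variable {d : ℕ} {lam C κ : ℝ}

theorem abs_faceExcess_le (hd : 0 < d) (hlam : 0 < lam) (hκ1 : κ < 1) (hdec : Decay d lam C κ)
    (f : Fin d × Bool) (k : ℕ) : |faceExcess lam f k| ≤ 2 * C * κ ^ k :=
  abs_domain_sub_domain_le hd hlam hκ1 hdec _ _ fun _ hu =>
    iff_of_true (mem_faceDomain_of_abs_le f (hu f.1)) trivial

theorem summable_faceExcess (hd : 0 < d) (hlam : 0 < lam) (hκ0 : 0 ≤ κ) (hκ1 : κ < 1)
    (hdec : Decay d lam C κ) (f : Fin d × Bool) : Summable (faceExcess lam f) :=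
  Summable.of_norm_bounded ((summable_geometric_of_lt_one hκ0 hκ1).mul_left (2 * C))
    fun k => abs_faceExcess_le hd hlam hκ1 hdec f k

/-- Let `t` be the depth below the second nearest face `f₂`. Up to distance `t` the box looks like
the half-space of the nearest face `f₁`, with error `2 * C * κ ^ t`, and each of the other `2d - 1`
faces has an excess of at most that size; this gives the factor `4 * d * C`. -/
theorem abs_energy_sub_faceExcess_le (hd : 0 < d) (hlam : 0 < lam) (hκ0 : 0 ≤ κ) (hκ1 : κ < 1)
    (hC : 0 ≤ C) (hdec : Decay d lam C κ) {N : Fin d → ℕ} {v : Node d} (hv : v ∈ box N) :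
    |limitEnergy lam ((box N : Set (Node d)) ∩ lexBelow v) v
        - (Domain.whole : Domain d).energy lam - ∑ f, faceExcess lam f (faceDepth N f v)|
      ≤ 4 * d * C * ∑ p ∈ (Finset.univ : Finset (Fin d × Bool)).offDiag,
          √κ ^ faceDepth N p.1 v * √κ ^ faceDepth N p.2 v := by
  obtain ⟨f₁, -, h₁⟩ := Finset.exists_min_image (Finset.univ : Finset (Fin d × Bool))
    (fun f => faceDepth N f v) ⟨(⟨0, hd⟩, true), Finset.mem_univ _⟩
  obtain ⟨f₂, hf₂, h₂⟩ := Finset.exists_min_image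
    ((Finset.univ : Finset (Fin d × Bool)).erase f₁) (fun f => faceDepth N f v)
    ⟨(f₁.1, !f₁.2), Finset.mem_erase.2 ⟨fun h => by simpa using congrArg Prod.snd h,
      Finset.mem_univ _⟩⟩
  have hne : f₂ ≠ f₁ := Finset.ne_of_mem_erase hf₂
  set t := faceDepth N f₂ v with ht
  have hmain := abs_limitEnergy_sub_domain_le hd hlam hκ1 hdec (Λ := (box N : Set (Node d)))
    (v := v) (faceDomain f₁ (faceDepth N f₁ v)) (t := t) (by
      intro u hu
      rw [Finset.mem_coe, add_mem_box_iff hv]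
      refine ⟨fun h => h f₁, fun h f => ?_⟩
      rcases eq_or_ne f f₁ with rfl | hf
      · exact h
      · refine mem_faceDomain_of_abs_le f ((hu f.1).trans ?_)
        exact_mod_cast h₂ f (Finset.mem_erase.2 ⟨hf, Finset.mem_univ f⟩))
  have hrest : |∑ f ∈ Finset.univ.erase f₁, faceExcess lam f (faceDepth N f v)|
      ≤ (2 * d - 1) * (2 * C * κ ^ t) := by
    refine (Finset.abs_sum_le_sum_abs _ _).trans ?_
    refine (Finset.sum_le_card_nsmul _ _ (2 * C * κ ^ t) fun f hf => ?_).trans (le_of_eq ?_)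
    · refine (abs_faceExcess_le hd hlam hκ1 hdec f _).trans ?_
      exact mul_le_mul_of_nonneg_left (pow_le_pow_of_le_one hκ0 hκ1.le (h₂ f hf)) (by linarith)
    · rw [nsmul_eq_mul, Finset.card_erase_of_mem (Finset.mem_univ _), Finset.card_univ,
        Fintype.card_prod, Fintype.card_fin, Fintype.card_bool, Nat.cast_sub (by omega)]
      push_cast
      ring
  have hbound : κ ^ t ≤ ∑ p ∈ (Finset.univ : Finset (Fin d × Bool)).offDiag,
      √κ ^ faceDepth N p.1 v * √κ ^ faceDepth N p.2 v := by
    have hmem : (f₁, f₂) ∈ (Finset.univ : Finset (Fin d × Bool)).offDiag := by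
      simp [hne.symm]
    refine le_trans ?_ (Finset.single_le_sum (f := fun p : (Fin d × Bool) × (Fin d × Bool) =>
      √κ ^ faceDepth N p.1 v * √κ ^ faceDepth N p.2 v) (fun p _ => by positivity) hmem)
    simp only
    rw [← pow_add]
    -- The nearest face has depth at most `t`, so `κ ^ t` can be shared between both faces at rate
    -- `√κ`. Summing over all pairs removes the dependence of `f₁` and `f₂` on `v`.
    calc κ ^ t = √κ ^ (2 * t) := by rw [pow_mul, Real.sq_sqrt hκ0]
      _ ≤ _ := pow_le_pow_of_le_one (Real.sqrt_nonneg κ)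
          (Real.sqrt_le_one.2 hκ1.le) (by
            have := h₁ f₂ (Finset.mem_univ _)
            omega)
  rw [← Finset.add_sum_erase _ _ (Finset.mem_univ f₁)]
  refine le_trans ?_ (mul_le_mul_of_nonneg_left hbound (by positivity))
  have e : limitEnergy lam ((box N : Set (Node d)) ∩ lexBelow v) v
        - (Domain.whole : Domain d).energy lam - (faceExcess lam f₁ (faceDepth N f₁ v)
          + ∑ f ∈ Finset.univ.erase f₁, faceExcess lam f (faceDepth N f v))
      = (limitEnergy lam ((box N : Set (Node d)) ∩ lexBelow v) v
        - (faceDomain f₁ (faceDepth N f₁ v)).energy lam)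
        - ∑ f ∈ Finset.univ.erase f₁, faceExcess lam f (faceDepth N f v) := by
    unfold faceExcess
    ring
  rw [e]
  refine (abs_sub _ _).trans ?_
  linarith

theorem abs_log_partitionFunction_box_sub_le (hd : 0 < d) (hlam : 0 < lam) (hκ0 : 0 ≤ κ)
    (hκ1 : κ < 1) (hC : 0 ≤ C) (hdec : Decay d lam C κ) (N : Fin d → ℕ) :
    |Real.log (partitionFunction d lam (box N))
        - (box N).card * (Domain.whole : Domain d).energy lam
        - ∑ f, sectionCard N f.1 * ∑ k ∈ Finset.range (2 * N f.1 + 1), faceExcess lam f k|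
      ≤ 4 * d * C * ∑ p ∈ (Finset.univ : Finset (Fin d × Bool)).offDiag,
          sectionCard N p.1.1 * pairBound √κ N p.1 p.2 := by
  have hx1 : √κ < 1 := by rw [Real.sqrt_lt' one_pos]; simpa using hκ1
  rw [log_partitionFunction_eq_sum hd hlam hκ0 hκ1 hdec,
    Finset.sum_congr rfl fun f _ => (sum_faceDepth N f (faceExcess lam f)).symm,
    Finset.sum_comm, ← nsmul_eq_mul, ← Finset.sum_const, ← Finset.sum_sub_distrib,
    ← Finset.sum_sub_distrib]
  refine (Finset.abs_sum_le_sum_abs _ _).trans ((Finset.sum_le_sum fun v hv =>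
    abs_energy_sub_faceExcess_le hd hlam hκ0 hκ1 hC hdec hv).trans ?_)
  rw [← Finset.mul_sum, Finset.sum_comm]
  refine mul_le_mul_of_nonneg_left (Finset.sum_le_sum fun p hp => ?_) (by positivity)
  exact sum_pow_faceDepth_le (Real.sqrt_nonneg κ) hx1 N (Finset.mem_offDiag.1 hp).2.2

end Surface

/-! ### Scaling limit of the rectangles -/

theorem rectangle_eq_box {d : ℕ} {a : Fin d → ℝ} (ha : ∀ j, 0 < a j) (n : ℕ) :
    rectangle a n = box fun j => ⌊a j * n⌋₊ := by
  unfold rectangle box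
  congr 1
  funext j
  simp only [Int.natCast_floor_eq_floor (mul_nonneg (ha j).le n.cast_nonneg)]

theorem tendsto_floor_mul {x : ℝ} (hx : 0 < x) :
    Filter.Tendsto (fun n : ℕ => ⌊x * n⌋₊) Filter.atTop Filter.atTop :=
  tendsto_nat_floor_atTop.comp (tendsto_natCast_atTop_atTop.const_mul_atTop hx)

theorem tendsto_sectionCard {d : ℕ} {a : Fin d → ℝ} (ha : ∀ j, 0 < a j) (j : Fin d) :
    Filter.Tendsto (fun n : ℕ => sectionCard (fun j => ⌊a j * n⌋₊) j / (n : ℝ) ^ (d - 1))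
      Filter.atTop (nhds (faceArea a j)) := by
  have h1 : ∀ i, Filter.Tendsto (fun n : ℕ => (2 * (⌊a i * n⌋₊ : ℝ) + 1) / n) Filter.atTop
      (nhds (2 * a i)) := by
    intro i
    have h := (((tendsto_nat_floor_mul_div_atTop (R := ℝ) (ha i).le).comp
      tendsto_natCast_atTop_atTop).const_mul 2).add (tendsto_inv_atTop_nhds_zero_nat (𝕜 := ℝ))
    rw [add_zero] at h
    refine h.congr fun n => ?_
    simp only [Function.comp_apply]
    ring
  have h2 := tendsto_finsetProd (Finset.univ.erase j) fun i _ => h1 i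
  refine h2.congr fun n => ?_
  rw [Finset.prod_div_distrib, Finset.prod_const, Finset.card_erase_of_mem (Finset.mem_univ j),
    Finset.card_univ, Fintype.card_fin]
  rfl

theorem tendsto_pairBound {d : ℕ} {a : Fin d → ℝ} (ha : ∀ j, 0 < a j) {x : ℝ} (hx0 : 0 ≤ x)
    (hx1 : x < 1) (f f' : Fin d × Bool) :
    Filter.Tendsto (fun n : ℕ => pairBound x (fun j => ⌊a j * n⌋₊) f f') Filter.atTop
      (nhds 0) := by
  unfold pairBound
  split_ifs with hj
  · have h1 := (tendsto_self_mul_const_pow_of_lt_one hx0 hx1).add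
      (tendsto_pow_atTop_nhds_zero_of_lt_one hx0 hx1)
    rw [add_zero] at h1
    have h2 := h1.comp ((tendsto_floor_mul (ha f.1)).const_mul_atTop' (two_pos : 0 < 2))
    refine h2.congr fun n => ?_
    simp only [Function.comp_apply]
    push_cast
    ring
  · refine Filter.Tendsto.const_div_atTop ?_ _
    refine Filter.tendsto_atTop_add_const_right _ _ (Filter.Tendsto.const_mul_atTop two_pos ?_)
    exact tendsto_natCast_atTop_atTop.comp (tendsto_floor_mul (ha f'.1))

/-- The surface pressure as a sum over the faces. -/
noncomputable def surfaceSum {d : ℕ} (lam : ℝ) (a : Fin d → ℝ) : ℝ :=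
  ∑ f : Fin d × Bool, faceArea a f.1 / totalArea a * ∑' k, faceExcess lam f k

theorem hasSurfacePressure {d : ℕ} {lam C κ : ℝ} (hd : 0 < d) (hlam : 0 < lam) (hκ0 : 0 ≤ κ)
    (hκ1 : κ < 1) (hC : 0 ≤ C) (hdec : Decay d lam C κ) {a : Fin d → ℝ} (ha : ∀ j, 0 < a j) :
    HasSurfacePressure d lam ((Domain.whole : Domain d).energy lam) a (surfaceSum lam a) := by
  have hx1 : √κ < 1 := by rw [Real.sqrt_lt' one_pos]; simpa using hκ1
  set N : ℕ → Fin d → ℕ := fun n j => ⌊a j * n⌋₊ with hN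
  -- Each section scales to its face area and each partial sum of excesses to its series; the
  -- remaining error vanishes because the section ratios converge and `pairBound` tends to `0`.
  have hmain : Filter.Tendsto (fun n : ℕ => ∑ f : Fin d × Bool,
      sectionCard (N n) f.1 / (n : ℝ) ^ (d - 1)
        * ∑ k ∈ Finset.range (2 * N n f.1 + 1), faceExcess lam f k) Filter.atTop
      (nhds (∑ f : Fin d × Bool, faceArea a f.1 * ∑' k, faceExcess lam f k)) := by
    refine tendsto_finsetSum _ fun f _ => (tendsto_sectionCard ha f.1).mul ?_
    refine (summable_faceExcess hd hlam hκ0 hκ1 hdec f).hasSum.tendsto_sum_nat.comp ?_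
    exact (Filter.tendsto_add_atTop_nat 1).comp
      ((tendsto_floor_mul (ha f.1)).const_mul_atTop' (two_pos : 0 < 2))
  have herr : Filter.Tendsto (fun n : ℕ => 4 * d * C *
      ∑ p ∈ (Finset.univ : Finset (Fin d × Bool)).offDiag,
        sectionCard (N n) p.1.1 / (n : ℝ) ^ (d - 1) * pairBound √κ (N n) p.1 p.2) Filter.atTop
      (nhds 0) := by
    have h := (tendsto_finsetSum ((Finset.univ : Finset (Fin d × Bool)).offDiag) fun p _ =>
      (tendsto_sectionCard ha p.1.1).mul
        (tendsto_pairBound ha (Real.sqrt_nonneg κ) hx1 p.1 p.2)).const_mul (4 * d * C)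
    simpa using h
  have hlim : Filter.Tendsto (fun n : ℕ => (Real.log (partitionFunction d lam (rectangle a n))
        - ((rectangle a n).card : ℝ) * (Domain.whole : Domain d).energy lam) / (n : ℝ) ^ (d - 1))
      Filter.atTop (nhds (∑ f : Fin d × Bool, faceArea a f.1 * ∑' k, faceExcess lam f k)) := by
    rw [← sub_zero (∑ f : Fin d × Bool, faceArea a f.1 * ∑' k, faceExcess lam f k)]
    have hdiff := squeeze_zero_norm (f := fun n : ℕ => (∑ f : Fin d × Bool,
      sectionCard (N n) f.1 / (n : ℝ) ^ (d - 1)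
        * ∑ k ∈ Finset.range (2 * N n f.1 + 1), faceExcess lam f k)
        - (Real.log (partitionFunction d lam (rectangle a n))
        - ((rectangle a n).card : ℝ) * (Domain.whole : Domain d).energy lam)
          / (n : ℝ) ^ (d - 1)) (fun n => ?_) herr
    · refine (hmain.sub hdiff).congr fun n => ?_
      ring
    · have h := abs_log_partitionFunction_box_sub_le hd hlam hκ0 hκ1 hC hdec (N n)
      rw [rectangle_eq_box ha, Real.norm_eq_abs, abs_sub_comm]
      have hn : (0 : ℝ) ≤ (n : ℝ) ^ (d - 1) := by positivity
      have h' := div_le_div_of_nonneg_right h hn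
      rw [← abs_of_nonneg hn, ← abs_div, abs_of_nonneg hn, sub_div, Finset.sum_div,
        mul_div_assoc, Finset.sum_div] at h'
      simpa only [mul_div_right_comm] using h'
  have h := hlim.div_const (totalArea a)
  unfold HasSurfacePressure surfaceSum
  have e : ∑ f : Fin d × Bool, faceArea a f.1 / totalArea a * ∑' k, faceExcess lam f k
      = (∑ f : Fin d × Bool, faceArea a f.1 * ∑' k, faceExcess lam f k) / totalArea a := by
    rw [Finset.sum_div]
    exact Finset.sum_congr rfl fun f _ => div_mul_eq_mul_div _ _ _
  rw [e]
  refine h.congr fun n => ?_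
  rw [div_div, mul_comm (totalArea a)]

/-! ### Accuracy and running time of the algorithm -/

theorem decay {d : ℕ} (hd : 2 ≤ d) {lam : ℝ} (hlam : 0 < lam)
    (hlam' : lam < (2 * (d : ℝ) - 1) ^ (2 * d - 1) / (2 * (d : ℝ) - 2) ^ (2 * d)) :
    ∃ C κ : ℝ, 0 ≤ C ∧ 0 ≤ κ ∧ κ < 1 ∧ Decay d lam C κ := by
  have hcast : ((2 * d - 1 : ℕ) : ℝ) = 2 * d - 1 := by
    rw [Nat.cast_sub (by omega)]
    push_cast
    ring
  have hlam'' : lam < ((2 * d - 1 : ℕ) : ℝ) ^ (2 * d - 1)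
      / (((2 * d - 1 : ℕ) : ℝ) - 1) ^ (2 * d - 1 + 1) := by
    rw [hcast, show 2 * d - 1 + 1 = 2 * d by omega,
      show 2 * (d : ℝ) - 1 - 1 = 2 * d - 2 by ring]
    exact hlam'
  refine ⟨2 * Real.arsinh √lam, √(rateSq (2 * d - 1) lam), ?_, Real.sqrt_nonneg _, ?_, ?_⟩
  · have := Real.arsinh_nonneg_iff.2 (Real.sqrt_nonneg lam)
    positivity
  · rw [Real.sqrt_lt' one_pos, one_pow]
    exact rateSq_lt_one hlam hlam''
  · intro f g hf hg t V v hv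
    exact abs_log_iterate_sub_le hd hlam hlam'' hf hg t V v hv

theorem natCast_mul_pow_le {κ : ℝ} (hκ0 : 0 ≤ κ) (hκ1 : κ < 1) (t : ℕ) :
    t * κ ^ t ≤ (1 - κ)⁻¹ := by
  refine le_trans ?_ (geom_sum_range_le hκ0 hκ1 t)
  have h := Finset.card_nsmul_le_sum (Finset.range t) (fun k => κ ^ k) (κ ^ t) fun k hk =>
    pow_le_pow_of_le_one hκ0 hκ1.le (Finset.mem_range.1 hk).le
  simpa using h

section Accuracy

variable {d : ℕ} {lam C κ : ℝ}

/-- Two errors: cutting the series at `t`, of order `κ ^ t`, and replacing `t` limits by values at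
depth `2 * t`, of order `t * κ ^ (2 * t)`. Depth `2 * t` leaves a spare `κ ^ t` that absorbs the
factor `t`. -/
theorem abs_sum_energy_sub_tsum_le (hd : 0 < d) (hlam : 0 < lam) (hκ0 : 0 ≤ κ) (hκ1 : κ < 1)
    (hC : 0 ≤ C) (hdec : Decay d lam C κ) (f : Fin d × Bool) (t : ℕ) :
    |∑ k ∈ Finset.range t, (energy lam (faceDomain f k).cavityNodes 0 (2 * t)
        - energy lam (Domain.whole : Domain d).cavityNodes 0 (2 * t)) - ∑' k, faceExcess lam f k|
      ≤ 4 * C / (1 - κ) * κ ^ t := by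
  have htail : |∑ k ∈ Finset.range t, faceExcess lam f k - ∑' k, faceExcess lam f k|
      ≤ 2 * C * κ ^ t / (1 - κ) :=
    norm_sub_le_of_geometric_bound_of_hasSum hκ1
      (fun k => abs_faceExcess_le hd hlam hκ1 hdec f k)
      (summable_faceExcess hd hlam hκ0 hκ1 hdec f).hasSum t
  have hhead : |∑ k ∈ Finset.range t, (energy lam (faceDomain f k).cavityNodes 0 (2 * t)
        - energy lam (Domain.whole : Domain d).cavityNodes 0 (2 * t))
        - ∑ k ∈ Finset.range t, faceExcess lam f k| ≤ t * (2 * C * κ ^ (2 * t)) := by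
    rw [← Finset.sum_sub_distrib]
    refine (Finset.abs_sum_le_sum_abs _ _).trans ?_
    refine (Finset.sum_le_card_nsmul _ _ (2 * C * κ ^ (2 * t)) fun k _ => ?_).trans (by simp)
    have h1 := abs_limitEnergy_sub_le hlam hκ1 hdec
      ((faceDomain f k).exists_neighbor_notMem hd) (2 * t)
    have h2 := abs_limitEnergy_sub_le hlam hκ1 hdec
      ((Domain.whole : Domain d).exists_neighbor_notMem hd) (2 * t)
    unfold faceExcess Domain.energy
    rw [abs_le] at *
    constructor <;> linarith [h1.1, h1.2, h2.1, h2.2]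
  have h1κ : 0 < 1 - κ := by linarith
  have hpow := mul_le_mul_of_nonneg_right (natCast_mul_pow_le hκ0 hκ1 t)
    (by positivity : 0 ≤ 2 * C * κ ^ t)
  have e1 : (t : ℝ) * (2 * C * κ ^ (2 * t)) = t * κ ^ t * (2 * C * κ ^ t) := by
    rw [two_mul t, pow_add]
    ring
  have e2 : (1 - κ)⁻¹ * (2 * C * κ ^ t) + 2 * C * κ ^ t / (1 - κ)
      = 4 * C / (1 - κ) * κ ^ t := by
    field_simp
    ring
  have h3 := abs_sub_le (∑ k ∈ Finset.range t, (energy lam (faceDomain f k).cavityNodes 0 (2 * t)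
        - energy lam (Domain.whole : Domain d).cavityNodes 0 (2 * t)))
    (∑ k ∈ Finset.range t, faceExcess lam f k) (∑' k, faceExcess lam f k)
  rw [e1] at hhead
  linarith

theorem scaSurfacePressure_val (d : ℕ) (lam : ℝ) (a : Fin d → ℝ) (c : ℕ) (ε : ℝ) :
    (scaSurfacePressure d lam a c ε).val
      = ∑ f : Fin d × Bool, faceArea a f.1 / totalArea a
        * ∑ k ∈ Finset.range (level c ε).val,
          (energy lam (faceDomain f k).cavityNodes 0 (2 * (level c ε).val)
            - energy lam (Domain.whole : Domain d).cavityNodes 0 (2 * (level c ε).val)) := by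
  simp only [scaSurfacePressure, bind_val, sum_val, Timed.div, Timed.mul, Timed.sub,
    computeFaceArea_val, logCavity_val]
  rw [← Fin.sum_univ_def, ← Fin.sum_univ_def, Fintype.sum_prod_type]
  refine Finset.sum_congr rfl fun j _ => ?_
  rw [Fintype.sum_bool, ← mul_add, ← Finset.sum_add_distrib]
  congr 1
  rw [← List.sum_toFinset _ List.nodup_range, List.toFinset_range]
  refine Finset.sum_congr rfl fun k _ => ?_
  simp only [energy, faceDomain, cond_true, cond_false]
  ring

theorem faceArea_pos {a : Fin d → ℝ} (ha : ∀ j, 0 < a j) (j : Fin d) : 0 < faceArea a j :=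
  Finset.prod_pos fun k _ => mul_pos two_pos (ha k)

theorem abs_scaSurfacePressure_sub_le (hd : 0 < d) (hlam : 0 < lam) (hκ0 : 0 ≤ κ) (hκ1 : κ < 1)
    (hC : 0 ≤ C) (hdec : Decay d lam C κ) {a : Fin d → ℝ} (ha : ∀ j, 0 < a j) (c : ℕ) (ε : ℝ) :
    |(scaSurfacePressure d lam a c ε).val - surfaceSum lam a|
      ≤ 8 * C / (1 - κ) * κ ^ (level c ε).val := by
  have : Nonempty (Fin d) := ⟨⟨0, hd⟩⟩
  have hA : 0 < totalArea a := Finset.sum_pos (fun j _ => faceArea_pos ha j) Finset.univ_nonempty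
  rw [scaSurfacePressure_val, surfaceSum, ← Finset.sum_sub_distrib]
  refine (Finset.abs_sum_le_sum_abs _ _).trans ?_
  refine (Finset.sum_le_sum (g := fun f : Fin d × Bool => faceArea a f.1 / totalArea a
    * (4 * C / (1 - κ) * κ ^ (level c ε).val)) fun f _ => ?_).trans (le_of_eq ?_)
  · have hw : 0 ≤ faceArea a f.1 / totalArea a := (div_pos (faceArea_pos ha _) hA).le
    rw [← mul_sub, abs_mul, abs_of_nonneg hw]
    exact mul_le_mul_of_nonneg_left
      (abs_sum_energy_sub_tsum_le hd hlam hκ0 hκ1 hC hdec f _) hw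
  -- The weights add up to `1` over the directions, and the two faces per direction double the
  -- constant.
  · rw [Fintype.sum_prod_type]
    simp only [Fintype.sum_bool, ← two_mul]
    rw [← Finset.mul_sum, ← Finset.sum_mul, ← Finset.sum_div]
    change 2 * (totalArea a / totalArea a * _) = _
    rw [div_self hA.ne']
    ring

theorem scaFreeEnergy_val (d : ℕ) (lam : ℝ) (c : ℕ) (ε : ℝ) :
    (scaFreeEnergy d lam c ε).val
      = (energy lam (Domain.whole : Domain d).cavityNodes 0 (2 * (level c ε).val),
        -Real.log ((cavityStep lam)^[2 * (level c ε).val] (fun _ _ => 0)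
          (Domain.whole : Domain d).cavityNodes 0)) := by
  simp only [scaFreeEnergy, bind_val, Timed.sub, logCavity_val, pure_val, zero_sub, energy]

theorem scaFreeEnergy_sub_le (hd : 0 < d) (hlam : 0 < lam) (hκ0 : 0 ≤ κ) (hκ1 : κ < 1)
    (hC : 0 ≤ C) (hdec : Decay d lam C κ) (c : ℕ) (ε : ℝ) (ht : 0 < (level c ε).val) :
    (scaFreeEnergy d lam c ε).val.2 - (scaFreeEnergy d lam c ε).val.1
      ≤ C * κ ^ (level c ε).val := by
  rw [scaFreeEnergy_val]
  set t := (level c ε).val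
  have h := abs_log_iterate_zero_sub_le hd hlam hdec (Domain.whole : Domain d) (2 * t - 1)
  rw [show 2 * t - 1 + 1 = 2 * t by omega] at h
  have h2 : C * κ ^ (2 * t - 1) ≤ C * κ ^ t :=
    mul_le_mul_of_nonneg_left (pow_le_pow_of_le_one hκ0 hκ1.le (by omega)) hC
  have h3 := (abs_le.1 h).2
  simp only [energy]
  linarith

end Accuracy

/-- The number of halvings made by the algorithm. -/
noncomputable def halvings (ε : ℝ) : ℕ := sInf {m : ℕ | (1 / 2 : ℝ) ^ m ≤ ε}

theorem half_pow_halvings_le {ε : ℝ} (hε : 0 < ε) : (1 / 2 : ℝ) ^ halvings ε ≤ ε := by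
  obtain ⟨m, hm⟩ := exists_pow_lt_of_lt_one hε (by norm_num : (1 / 2 : ℝ) < 1)
  exact Nat.sInf_mem (s := {m : ℕ | (1 / 2 : ℝ) ^ m ≤ ε}) ⟨m, hm.le⟩

/-- By minimality, one halving fewer leaves more than `ε`, so `2 ^ (m - 1) < 1 / ε`; the missing
factor `4` is at most `M ^ 2` since `M ≥ 2`. -/
theorem two_pow_halvings_le {ε : ℝ} (hε : 0 < ε) :
    (2 : ℝ) ^ (halvings ε + 1) ≤ (max 2 (1 / ε)) ^ 3 := by
  set M := max 2 (1 / ε) with hM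
  have hM2 : 2 ≤ M := le_max_left _ _
  rcases Nat.eq_zero_or_pos (halvings ε) with h | h
  · rw [h, zero_add, pow_one]
    exact hM2.trans (le_self_pow₀ (by linarith) (by norm_num))
  · obtain ⟨k, hk⟩ : ∃ k, halvings ε = k + 1 := ⟨halvings ε - 1, by omega⟩
    have hnot : ¬ (1 / 2 : ℝ) ^ k ≤ ε := fun h' => by
      have : halvings ε ≤ k := Nat.sInf_le h'
      omega
    have hlt : (2 : ℝ) ^ k ≤ M := by
      refine le_trans ?_ (le_max_right _ _)
      rw [not_le, one_div, inv_pow] at hnot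
      rw [one_div]
      exact (le_inv_comm₀ hε (by positivity)).1 hnot.le
    rw [hk]
    calc (2 : ℝ) ^ (k + 1 + 1) = 2 ^ k * 2 ^ 2 := by ring
      _ ≤ M * M ^ 2 := mul_le_mul hlt (pow_le_pow_left₀ two_pos.le hM2 2) (by positivity)
          (by linarith)
      _ = M ^ 3 := by ring

theorem level_val (c : ℕ) (ε : ℝ) : (level c ε).val = c * (halvings ε + 1) := rfl

theorem level_cost (c : ℕ) (ε : ℝ) : (level c ε).cost = 3 * halvings ε + 3 := rfl

/-! ### Polynomial running time -/

section Time

variable {d c : ℕ}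

theorem le_costRate (d : ℕ) : 24 ≤ costRate d ∧ d ≤ costRate d := by
  have h1 : 1 ≤ (d + 1) ^ 3 := Nat.one_le_pow _ _ (by omega)
  have h2 : d + 1 ≤ (d + 1) ^ 3 := Nat.le_self_pow (by norm_num) _
  unfold costRate
  omega

/-- With `X` the cost scale of one evaluation, `d`, `t` and the number of halvings are all at most
`X`, so the total is a cubic polynomial in `X`; `X ≥ 24` lets `X ^ 5` absorb its coefficients. -/
theorem sca_cost_le_pow (lam : ℝ) (hc : 0 < c) (ε : ℝ) :
    (scaFreeEnergy d lam c ε).cost ≤ (costRate d ^ (2 * (level c ε).val + 1)) ^ 5 ∧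
      ∀ a : Fin d → ℝ,
        (scaSurfacePressure d lam a c ε).cost
          ≤ (costRate d ^ (2 * (level c ε).val + 1)) ^ 5 := by
  obtain ⟨hK, hdK⟩ := le_costRate d
  have hF := scaFreeEnergy_cost_le d lam c ε
  have hS := fun a => scaSurfacePressure_cost_le d lam a c ε
  rw [level_cost] at hF
  simp only [level_cost] at hS
  have ht : halvings ε + 1 ≤ (level c ε).val := by
    rw [level_val]
    exact Nat.le_mul_of_pos_left _ hc
  set t := (level c ε).val
  have hKX : costRate d ≤ costRate d ^ (2 * t + 1) := Nat.le_self_pow (by omega) _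
  have htX : t ≤ costRate d ^ (2 * t + 1) :=
    calc t ≤ 2 * t + 1 := by omega
      _ ≤ _ := (Nat.lt_pow_self (by omega)).le
  set X := costRate d ^ (2 * t + 1)
  have hX : 24 ≤ X := hK.trans hKX
  have hdX : d ≤ X := hdK.trans hKX
  have hX1 : 1 ≤ X := by omega
  have hX2 : X ≤ X ^ 2 := Nat.le_self_pow (by norm_num) _
  have hX3 : X ^ 2 ≤ X ^ 3 := Nat.pow_le_pow_right hX1 (by norm_num)
  have hX5 : 34 * X ^ 3 ≤ X ^ 5 := by
    calc 34 * X ^ 3 ≤ X ^ 2 * X ^ 3 := Nat.mul_le_mul_right _ (by nlinarith)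
      _ = X ^ 5 := by ring
  refine ⟨by omega, fun a => (hS a).trans ?_⟩
  have e1 : d * (3 + d * 4) ≤ X * (3 + X * 4) := by gcongr
  have e2 : d * (6 + d * 4 + t * (2 * X + 7)) ≤ X * (6 + X * 4 + X * (2 * X + 7)) := by gcongr
  have e3 : X * (3 + X * 4) = 3 * X + 4 * X ^ 2 := by ring
  have e4 : X * (6 + X * 4 + X * (2 * X + 7)) = 6 * X + 11 * X ^ 2 + 2 * X ^ 3 := by ring
  omega

/-- The exponent is at most `(2 * c + 1) * (halvings ε + 1)`. Writing the base as at most `2` to its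
own power turns this into a fixed power of `2 ^ (halvings ε + 1)`; the `15` is `3 * 5`, from the
cube in `two_pow_halvings_le` and the fifth power. -/
theorem costRate_pow_le (d : ℕ) {ε : ℝ} (hε : 0 < ε) :
    (((costRate d ^ (2 * (level c ε).val + 1)) ^ 5 : ℕ) : ℝ)
      ≤ (max 2 (1 / ε)) ^ (15 * costRate d ^ (2 * c + 1)) := by
  obtain ⟨hK, -⟩ := le_costRate d
  have h1 : costRate d ^ (2 * (level c ε).val + 1)
      ≤ (2 ^ (halvings ε + 1)) ^ (costRate d ^ (2 * c + 1)) :=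
    calc costRate d ^ (2 * (level c ε).val + 1)
        ≤ costRate d ^ ((2 * c + 1) * (halvings ε + 1)) := by
          refine Nat.pow_le_pow_right (by omega) ?_
          rw [level_val]
          nlinarith
      _ = (costRate d ^ (2 * c + 1)) ^ (halvings ε + 1) := pow_mul _ _ _
      _ ≤ (2 ^ (costRate d ^ (2 * c + 1))) ^ (halvings ε + 1) :=
          Nat.pow_le_pow_left (Nat.lt_two_pow_self).le _
      _ = _ := by rw [← pow_mul, ← pow_mul, mul_comm]
  have h2 : ((costRate d ^ (2 * (level c ε).val + 1) : ℕ) : ℝ)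
      ≤ ((2 : ℝ) ^ (halvings ε + 1)) ^ (costRate d ^ (2 * c + 1)) := by exact_mod_cast h1
  rw [Nat.cast_pow]
  calc (((costRate d ^ (2 * (level c ε).val + 1) : ℕ) : ℝ)) ^ 5
      ≤ (((2 : ℝ) ^ (halvings ε + 1)) ^ (costRate d ^ (2 * c + 1))) ^ 5 :=
        pow_le_pow_left₀ (Nat.cast_nonneg _) h2 5
    _ ≤ (((max 2 (1 / ε)) ^ 3) ^ (costRate d ^ (2 * c + 1))) ^ 5 := by
        gcongr
        exact two_pow_halvings_le hε
    _ = _ := by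
        rw [← pow_mul, ← pow_mul]
        congr 1
        ring

end Time

/-- A constant for which the accuracy is reached at every level. -/
theorem exists_level_constant {D κ : ℝ} (hκ0 : 0 ≤ κ) (hκ1 : κ < 1) :
    ∃ c : ℕ, 0 < c ∧ ∀ ε : ℝ, 0 < ε → D * κ ^ (level c ε).val ≤ ε := by
  have hpow := tendsto_pow_atTop_nhds_zero_of_lt_one hκ0 hκ1
  have hmul : Filter.Tendsto (fun c => D * κ ^ c) Filter.atTop (nhds 0) := by
    simpa using hpow.const_mul D
  -- One block of `c` levels absorbs the constant `D`, and each further block gains a factor `1 /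
  -- 2`, matching one halving; hence the `m + 1` in `level`.
  obtain ⟨c, ⟨h1, h2⟩, h3⟩ := (((hpow.eventually_le_const (by norm_num : (0 : ℝ) < 1 / 2)).and
    (hmul.eventually_le_const one_pos)).and (Filter.eventually_gt_atTop 0)).exists
  refine ⟨c, h3, fun ε hε => ?_⟩
  rw [level_val, mul_add, mul_one, pow_add, pow_mul, mul_comm _ (κ ^ c), ← mul_assoc]
  calc D * κ ^ c * (κ ^ c) ^ halvings ε ≤ 1 * (κ ^ c) ^ halvings ε :=
        mul_le_mul_of_nonneg_right h2 (by positivity)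
    _ ≤ (1 / 2) ^ halvings ε := by
        rw [one_mul]
        exact pow_le_pow_left₀ (by positivity) h1 _
    _ ≤ ε := half_pow_halvings_le hε

end HardCore

theorem proposition2 (d : ℕ) (hd : 2 ≤ d) (lam : ℝ) (hlam : 0 < lam)
    (hlam' : lam < (2 * (d : ℝ) - 1) ^ (2 * d - 1) / (2 * (d : ℝ) - 2) ^ (2 * d)) :
    ∃ (P : ℝ) (sP : (Fin d → ℝ) → ℝ),
      HardCore.HasFreeEnergy d lam P ∧
      (∀ a : Fin d → ℝ, (∀ j, 0 < a j) → HardCore.HasSurfacePressure d lam P a (sP a)) ∧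
      ∃ c C : ℕ, ∀ ε : ℝ, 0 < ε →
        ((HardCore.scaFreeEnergy d lam c ε).val.1 ≤ P ∧
          P ≤ (HardCore.scaFreeEnergy d lam c ε).val.2 ∧
          (HardCore.scaFreeEnergy d lam c ε).val.2
            - (HardCore.scaFreeEnergy d lam c ε).val.1 ≤ ε ∧
          ((HardCore.scaFreeEnergy d lam c ε).cost : ℝ) ≤ (max 2 (1 / ε)) ^ C) ∧
        ∀ a : Fin d → ℝ, (∀ j, 0 < a j) →
          |(HardCore.scaSurfacePressure d lam a c ε).val - sP a| ≤ ε ∧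
          ((HardCore.scaSurfacePressure d lam a c ε).cost : ℝ) ≤ (max 2 (1 / ε)) ^ C := by
  have hd0 : 0 < d := by omega
  obtain ⟨C, κ, hC, hκ0, hκ1, hdec⟩ := HardCore.decay hd hlam hlam'
  have h1κ : 0 < 1 - κ := by linarith
  -- `D` is the error constant of the surface pressure; it is at least `C`, so the same `c` serves
  -- the free energy.
  obtain ⟨c, hc, hacc⟩ := HardCore.exists_level_constant (D := 8 * C / (1 - κ)) hκ0 hκ1
  refine ⟨(HardCore.Domain.whole : HardCore.Domain d).energy lam, HardCore.surfaceSum lam,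
    HardCore.hasFreeEnergy hd0 hlam hκ0 hκ1 hC hdec,
    fun a ha => HardCore.hasSurfacePressure hd0 hlam hκ0 hκ1 hC hdec ha,
    c, 15 * HardCore.costRate d ^ (2 * c + 1), fun ε hε => ⟨⟨?_, ?_, ?_, ?_⟩, fun a ha => ⟨?_, ?_⟩⟩⟩
  · rw [HardCore.scaFreeEnergy_val]
    exact HardCore.energy_two_mul_le hd0 hlam hκ1 hdec _ _
  · rw [HardCore.scaFreeEnergy_val]
    exact HardCore.le_neg_log_iterate_zero hd0 hlam hκ1 hdec _ (Nat.mul_pos hc (Nat.succ_pos _))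
  · refine (HardCore.scaFreeEnergy_sub_le hd0 hlam hκ0 hκ1 hC hdec c ε
      (Nat.mul_pos hc (Nat.succ_pos _))).trans (le_trans ?_ (hacc ε hε))
    refine mul_le_mul_of_nonneg_right ?_ (pow_nonneg hκ0 _)
    rw [le_div_iff₀ h1κ]
    nlinarith
  · exact (Nat.cast_le.2 (HardCore.sca_cost_le_pow lam hc ε).1).trans
      (HardCore.costRate_pow_le d hε)
  · exact (HardCore.abs_scaSurfacePressure_sub_le hd0 hlam hκ0 hκ1 hC hdec ha c ε).trans
      (hacc ε hε)
  · exact (Nat.cast_le.2 ((HardCore.sca_cost_le_pow lam hc ε).2 a)).trans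
      (HardCore.costRate_pow_le d hε)
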